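/- Let $k$ be a field, $R$ a commutative $k$-algebra, and $\mathfrak D=\mathrm{Der}_k(R)$. *Trees.* For a set $\mathfrak S$ let $k\mathcal{LT}(\mathfrak S)$ be the $k$-vector space whose basis is the set of finite ordered rooted trees with every non root node labeled by an element of $\mathfrak S$. It is a cocommutative graded connected Hopf algebra. The product $T_1\cdot T_2$ is the sum, over all maps $d$ from the children of the root of $T_1$ to the nodes of $T_2$, of the tree obtained by linking each child $c$ (with its subtree) to the node $d(c)$; new children of a node precede its old children and keep their order from $T_1$. The unit is the tree with one node. The coproduct is $\Delta(T)=\sum_{\mathcal X}T_{\mathcal X}\otimes T_{\mathcal F\setminus\mathcal X}$, where $\mathcal F$ is the ordered family of subtrees attached to the root of $T$, $\mathcal X$ runs over its subfamilies, and $T_{\mathcal X}$ is $\mathcal X$ attached to a new root. The counit is $1$ on the one-node tree and $0$ on all other trees. For a non root node $i$ of $T$, $T_i$ is the subtree whose (unlabeled) root is $i$, and $T(i,E,T')$ is $T$ with $i$ relabeled by $E$ and $T_i$ replaced by $T'$ (extended linearly in $T'$). *Actions.* Suppose that $R$ is a $k\mathcal{LT}(\mathfrak D)$-module algebra, that is,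 a left module with $h\cdot(rs)=\sum (h_{(1)}\cdot r)(h_{(2)}\cdot s)$, and that the action is Leibnitz: for every tree $T$, every non root node $i$ of $T$, every way of writing the label of $i$ as a finite sum $\sum_u r_uE_u$ with $r_u\in R$, $E_u\in\mathfrak D$, and every $s\in R$, $$T\cdot s=\sum_u\sum_{(T_i)}(T_{i(1)}\cdot r_u)\,\bigl(T(i,E_u,T_{i(2)})\cdot s\bigr).$$ Let $\mathcal I(k\mathcal{LT}(\mathfrak D))$ be the $R$-linear span in $R\# k\mathcal{LT}(\mathfrak D)$ of the elements $$1\# T-\sum_u\sum_{(T_i)}(T_{i(1)}\cdot r_u)\# T(i,E_u,T_{i(2)})$$ for all such $T$, $i$ and expressions $\sum_u r_uE_u$ of the label of $i$. *Smash products.* Let $H$ be $k\mathcal{LT}(\mathfrak D)$, or $k\mathcal{LT}(\mathfrak B)$ acting through $k\mathcal{LT}(\mathfrak B)\subseteq k\mathcal{LT}(\mathfrak D)$. Then $R\# H=R\otimes_kH$ is the $R/k$-Hopf algebra with product $(r\#h)(s\#g)=\sum r(h_{(1)}\cdot s)\#h_{(2)}g$, coproduct $r\#h\mapsto\sum(r\#h_{(1)})\otimes_R(1\#h_{(2)})$,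 counit $r\#h\mapsto r\varepsilon(h)$, and antiproduct $r\#h\mapsto\sum(r\#h_{(1)})\otimes_r(1\#\sigma(h_{(2)}))$, where $\sigma$ is the antipode of $H$ and $B\otimes_rB$ is the tensor product in which $bs\otimes c=b\otimes sc$ for $s\in R$. **Theorem 5.1.** Assume moreover that $\mathfrak D$ is free as an $R$-module, with $R$-basis $\mathfrak B$. Then there is exactly one $R$-linear map $\alpha_{\mathfrak B}:R\# k\mathcal{LT}(\mathfrak D)\to R\# k\mathcal{LT}(\mathfrak B)$ that is the identity on the trees with all labels in $\mathfrak B$ and is invariant under the substitutions $$1\# T\ \longmapsto\ \sum_u\sum_{(T_i)}(T_{i(1)}\cdot r_u)\# T(i,X_u,T_{i(2)}),$$ where $i$ is any non root node of a tree $T$ and $\sum_u r_uX_u$ ($r_u\in R$, $X_u\in\mathfrak B$) is the expansion of its label in the basis (so that repeated substitution gives a well-defined map). The subspace $\mathcal I(k\mathcal{LT}(\mathfrak D))$ is an $R/k$-Hopf ideal, i.e. a two-sided ideal on which the counit is $0$ and the coproduct and the antiproduct are $0$ modulo it. The map $\alpha_{\mathfrak B}$ is a homomorphism of $R/k$-Hopf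 algebras with kernel $\mathcal I(k\mathcal{LT}(\mathfrak D))$, and it induces an isomorphism $$R\# k\mathcal{LT}(\mathfrak D)\,/\,\mathcal I(k\mathcal{LT}(\mathfrak D))\ \cong\ R\# k\mathcal{LT}(\mathfrak B).$$ -/

import Mathlib

open scoped TensorProduct

/-! ### Labeled ordered trees -/

/-- Finite ordered trees in which each node other than the root is labeled by an element of `S`.
`one` is the tree with only one node (the root).  `cons E C F` is the tree whose root has a first
child with label `E`, where `C` is the subtree attached to that child (the child itself being the
unlabeled root of `C`), and `F` is the tree formed by the root and its remaining children. -/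
inductive OTree (S : Type*) where
  | one : OTree S
  | cons (E : S) (C F : OTree S) : OTree S

namespace OTree

variable {S S' : Type*}

/-- Change of labels. -/
def map (f : S → S') : OTree S → OTree S'
  | one => one
  | cons E C F => cons (f E) (map f C) (map f F)

/-- Identify the roots of two trees; the children of the root of the first tree precede those of
the root of the second. -/
def join : OTree S → OTree S → OTree S
  | one, G => G
  | cons E C F, G => cons E C (join F G)

/-- All pairs `(T_X, T_{F \ X})`, where `F` is the ordered family of children of the root of the
tree (with the full subtrees attached to them), and `X` runs over its `2 ^ n` subfamilies. -/
def splits : OTree S → List (OTree S × OTree S)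
  | one => [(one, one)]
  | cons E C F =>
      (splits F).map (fun p => (cons E C p.1, p.2)) ++
      (splits F).map (fun p => (p.1, cons E C p.2))

/-- All trees obtained by linking each child of the root of the first tree to some node *other than
the root* of the second tree.  New children of a node precede its old children, and keep the order
they had in the first tree.  (In the second case, the children in `A` are linked to the first child
of the root, those in `B` to its proper descendants, and those in `D` to nodes of `F`.) -/
def inner : OTree S → OTree S → List (OTree S)
  | one, one => [one]
  | cons _ _ _, one => []
  | T, cons E C F =>
      (splits T).flatMap fun p =>
        let D := p.2
        (splits p.1).flatMap fun q =>
          let A := q.1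
          let B := q.2
          (inner B C).flatMap fun C' => (inner D F).map fun F' => cons E (join A C') F'

/-- The terms of the product of two trees: each child of the root of `T₁` is linked to some node of
`T₂` (the children in `A` to the root, those in `B` to other nodes), in all possible ways.
New children of a node precede its old children, and keep the order they had in `T₁`. -/
def prod (T₁ T₂ : OTree S) : List (OTree S) :=
  (splits T₁).flatMap fun p =>
    let A := p.1
    let B := p.2
    (inner B T₂).map fun T => join A T

/-- The nodes of a tree other than its root. -/
inductive Node : OTree S → Type _ where
  /-- the first child of the root -/
  | here {E : S} {C F : OTree S} : Node (cons E C F)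
  /-- a proper descendant of the first child of the root -/
  | down {E : S} {C F : OTree S} (i : Node C) : Node (cons E C F)
  /-- another child of the root, or one of its descendants -/
  | next {E : S} {C F : OTree S} (i : Node F) : Node (cons E C F)

/-- The label of a non root node. -/
def Node.label : {T : OTree S} → Node T → S
  | cons E _ _, .here => E
  | _, .down i => i.label
  | _, .next i => i.label

/-- The subtree `T_i` whose (unlabeled) root is the node `i`. -/
def Node.sub : {T : OTree S} → Node T → OTree S
  | cons _ C _, .here => C
  | _, .down i => i.sub
  | _, .next i => i.sub

/-- The tree `T(i, G, T')`: the node `i` gets the label `G`, and the subtree rooted at `i` is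
replaced by `T'`. -/
def Node.replace (G : S) (T' : OTree S) : {T : OTree S} → Node T → OTree S
  | cons _ _ F, .here => cons G T' F
  | cons E _ F, .down i => cons E (i.replace G T') F
  | cons E C _, .next i => cons E C (i.replace G T')

end OTree

noncomputable section

/-! ### The Hopf algebra of trees -/

/-- The `k`-vector space with basis the labeled ordered trees. -/
abbrev KLT (k : Type*) [Field k] (S : Type*) : Type _ := OTree S →₀ k

namespace KLT

variable {k : Type*} [Field k] {S S' : Type*}

/-- A tree, as an element of `KLT k S`. -/
def tree (T : OTree S) : KLT k S := Finsupp.single T 1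

/-- The product of `KLT k S`. -/
def mul : KLT k S →ₗ[k] KLT k S →ₗ[k] KLT k S :=
  Finsupp.linearCombination k fun T₁ =>
    Finsupp.linearCombination k fun T₂ => ((T₁.prod T₂).map tree).sum

/-- The coproduct of `KLT k S`. -/
def comul : KLT k S →ₗ[k] KLT k S ⊗[k] KLT k S :=
  Finsupp.linearCombination k fun T => (T.splits.map fun p => tree p.1 ⊗ₜ[k] tree p.2).sum

/-- The counit of `KLT k S`. -/
def counit : KLT k S →ₗ[k] k :=
  Finsupp.linearCombination k fun
    | OTree.one => 1
    | OTree.cons _ _ _ => 0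

/-- `σ` is the antipode of the bialgebra `KLT k S`:
`∑ σ(h₁) h₂ = ε(h) 1 = ∑ h₁ σ(h₂)`. -/
def IsAntipode (σ : KLT k S →ₗ[k] KLT k S) : Prop :=
  ∀ h : KLT k S,
    TensorProduct.lift (mul.compl₁₂ σ LinearMap.id) (comul h) = counit h • tree OTree.one ∧
    TensorProduct.lift (mul.compl₁₂ LinearMap.id σ) (comul h) = counit h • tree OTree.one

/-- The linear map `KLT k S → KLT k S'` induced by a map of labels. -/
def mapLabel (f : S → S') : KLT k S →ₗ[k] KLT k S' := Finsupp.lmapDomain k k (OTree.map f)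

end KLT

open KLT

section Smash

variable {k : Type*} [Field k] {R : Type*} [CommRing R] [Algebra k R] {S : Type*}

/-- The linear map `ψ`, `h · r = ψ h r`, is a left `KLT k S`-module algebra structure on `R`. -/
structure IsModuleAlgebra (ψ : KLT k S →ₗ[k] Module.End k R) : Prop where
  one_act : ∀ r : R, ψ (tree OTree.one) r = r
  mul_act : ∀ (g h : KLT k S) (r : R), ψ (mul g h) r = ψ g (ψ h r)
  act_mul : ∀ (h : KLT k S) (r s : R),
    ψ h (r * s) = LinearMap.mul' k R (TensorProduct.map (ψ.flip r) (ψ.flip s) (comul h))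

variable (k R S) in
/-- The underlying space of the smash product `R # KLT k S`, with its left `R`-module structure. -/
abbrev Smash : Type _ := R ⊗[k] KLT k S

/-- The multiplication `(r # h) (s # g) = ∑ r (h₁ · s) # h₂ g` of the smash product. -/
def smashMul (ψ : KLT k S →ₗ[k] Module.End k R) :
    Smash k R S →ₗ[k] Smash k R S →ₗ[k] Smash k R S :=
  TensorProduct.lift <|
    (LinearMap.mul k (Module.End k (Smash k R S))).compl₁₂
      (LinearMap.rTensorHom (KLT k S) ∘ₗ LinearMap.mul k R)
      (TensorProduct.lift ((TensorProduct.mapBilinear (RingHom.id k) R (KLT k S) R (KLT k S)).compl₁₂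
        ψ mul) ∘ₗ comul)

theorem smashMul_tmul (ψ : KLT k S →ₗ[k] Module.End k R) (r s : R) (T : OTree S) (g : KLT k S) :
    smashMul ψ (r ⊗ₜ tree T) (s ⊗ₜ g) =
      (T.splits.map fun p => (r * ψ (tree p.1) s) ⊗ₜ[k] mul (tree p.2) g).sum := by
  have key : ∀ l : List (OTree S × OTree S),
      (LinearMap.rTensor (KLT k S) (LinearMap.mul k R r))
        ((TensorProduct.lift ((TensorProduct.mapBilinear (RingHom.id k) R (KLT k S) R
          (KLT k S)).compl₁₂ ψ mul)
          (l.map fun p => tree p.1 ⊗ₜ[k] tree p.2).sum) (s ⊗ₜ g)) =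
      (l.map fun p => (r * ψ (tree p.1) s) ⊗ₜ[k] mul (tree p.2) g).sum := by
    intro l
    induction l with
    | nil => simp
    | cons p l ih => simp [ih]
  have hc : (comul (tree T : KLT k S)) =
      (T.splits.map fun p => tree p.1 ⊗ₜ[k] tree p.2).sum := by
    simp [comul, tree]
  simpa [smashMul, hc] using key T.splits

variable (k R S) in
/-- The unit `1 # 1` of the smash product. -/
def smashOne : Smash k R S := 1 ⊗ₜ tree OTree.one

variable (k R S) in
/-- The coproduct of the smash product, as an `R`-coalgebra:
`R ⊗ H → R ⊗ (H ⊗ H) ≅ (R ⊗ H) ⊗[R] (R ⊗ H)`. -/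
def smashComul : Smash k R S →ₗ[R] Smash k R S ⊗[R] Smash k R S :=
  (TensorProduct.AlgebraTensorModule.distribBaseChange k R (KLT k S) (KLT k S)).toLinearMap ∘ₗ
    (comul (k := k) (S := S)).baseChange R

variable (k R S) in
/-- The counit `r # h ↦ r ε(h)` of the smash product. -/
def smashCounit : Smash k R S →ₗ[R] R :=
  (TensorProduct.AlgebraTensorModule.rid k R R).toLinearMap ∘ₗ
    (counit (k := k) (S := S)).baseChange R

/-- Let `B` be the smash product, an `R`-`R`-bimodule through `R ⊆ B`.  The tensor product
`B ⊗_r B`, in which `b s ⊗ c = b ⊗ s c` for `s ∈ R`, is the quotient of `B ⊗[k] B` by this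
subspace. -/
def middleRel (ψ : KLT k S →ₗ[k] Module.End k R) :
    Submodule k (Smash k R S ⊗[k] Smash k R S) :=
  Submodule.span k
    {z | ∃ (x y : Smash k R S) (s : R),
      z = smashMul ψ x (s ⊗ₜ tree OTree.one) ⊗ₜ[k] y - x ⊗ₜ[k] smashMul ψ (s ⊗ₜ tree OTree.one) y}

/-- The antiproduct `r # h ↦ ∑ (r # h₁) ⊗ (1 # σ(h₂))`, where `σ` is the antipode of `KLT k S`, is
the composite of this map with the projection of `B ⊗[k] B` onto `B ⊗_r B`. -/
def antiproduct (σ : KLT k S →ₗ[k] KLT k S) :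
    Smash k R S →ₗ[k] Smash k R S ⊗[k] Smash k R S :=
  (TensorProduct.map LinearMap.id (TensorProduct.mk k R (KLT k S) 1 ∘ₗ σ)) ∘ₗ
    (TensorProduct.assoc k R (KLT k S) (KLT k S)).symm.toLinearMap ∘ₗ
    (comul (k := k) (S := S)).lTensor R

/-- `I` is an `R/k`-Hopf ideal of the smash product (so that the quotient by `I` inherits
the structure of an `R/k`-Hopf algebra): a two-sided ideal, on which the counit vanishes, and on
which the coproduct and the antiproduct vanish when they are followed by the projection `π ⊗ π` to
the respective tensor square of the quotient. -/
structure IsHopfIdeal (ψ : KLT k S →ₗ[k] Module.End k R) (σ : KLT k S →ₗ[k] KLT k S)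
    (I : Submodule R (Smash k R S)) : Prop where
  mul_mem_left : ∀ x, ∀ y ∈ I, smashMul ψ x y ∈ I
  mul_mem_right : ∀ x ∈ I, ∀ y, smashMul ψ x y ∈ I
  counit_eq : ∀ x ∈ I, smashCounit k R S x = 0
  comul_eq : ∀ x ∈ I, TensorProduct.map I.mkQ I.mkQ (smashComul k R S x) = 0
  antiproduct_mem : ∀ x ∈ I,
    TensorProduct.map (I.mkQ.restrictScalars k) (I.mkQ.restrictScalars k) (antiproduct σ x) ∈
      (middleRel ψ).map
        (TensorProduct.map (I.mkQ.restrictScalars k) (I.mkQ.restrictScalars k))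

/-- The `R`-linear map `α` between two smash products is a homomorphism of `R/k`-Hopf algebras. -/
structure IsHopfHom {S' : Type*}
    (ψ : KLT k S →ₗ[k] Module.End k R) (σ : KLT k S →ₗ[k] KLT k S)
    (ψ' : KLT k S' →ₗ[k] Module.End k R) (σ' : KLT k S' →ₗ[k] KLT k S')
    (α : Smash k R S →ₗ[R] Smash k R S') : Prop where
  map_one : α (smashOne k R S) = smashOne k R S'
  map_mul : ∀ x y, α (smashMul ψ x y) = smashMul ψ' (α x) (α y)
  map_counit : ∀ x, smashCounit k R S' (α x) = smashCounit k R S x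
  map_comul : ∀ x, smashComul k R S' (α x) = TensorProduct.map α α (smashComul k R S x)
  map_antiproduct : ∀ x,
    antiproduct σ' (α x) -
      TensorProduct.map (α.restrictScalars k) (α.restrictScalars k) (antiproduct σ x) ∈
        middleRel ψ'

end Smash

/-! ### Leibnitz structures and the relabeling map -/

section Leibnitz

variable {k : Type*} [Field k] {R : Type*} [CommRing R] [Algebra k R]

/-- The `KLT k (Der R)`-module algebra structure `ψ` on `R` is Leibnitz: whenever the label of the
non root node `i` of a tree `T` is written as an `R`-linear combination `∑ r_u E_u` of derivations,
`T · s = ∑_u ∑ ((T_i)₁ · r_u) (T(i, E_u, (T_i)₂) · s)`. -/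
def IsLeibnitz (ψ : KLT k (Derivation k R R) →ₗ[k] Module.End k R) : Prop :=
  ∀ (T : OTree (Derivation k R R)) (i : T.Node) (n : ℕ) (r : Fin n → R)
    (E : Fin n → Derivation k R R), i.label = ∑ u, r u • E u → ∀ s : R,
      ψ (tree T) s =
        ∑ u, (i.sub.splits.map fun p =>
          ψ (tree p.1) (r u) * ψ (tree (i.replace (E u) p.2)) s).sum

/-- The `R`-linear span of the elements `1 # T - ∑_u ∑ (T_i)₁ · r_u # T(i, E_u, (T_i)₂)`, where `i`
is a non root node of the tree `T` with label `∑ r_u E_u`. -/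
def leibnitzIdeal (ψ : KLT k (Derivation k R R) →ₗ[k] Module.End k R) :
    Submodule R (Smash k R (Derivation k R R)) :=
  Submodule.span R
    {x | ∃ (T : OTree (Derivation k R R)) (i : T.Node) (n : ℕ) (r : Fin n → R)
      (E : Fin n → Derivation k R R), i.label = ∑ u, r u • E u ∧
        x = 1 ⊗ₜ tree T -
          ∑ u, (i.sub.splits.map fun p =>
            ψ (tree p.1) (r u) ⊗ₜ[k] tree (i.replace (E u) p.2)).sum}

/-- Let `b` be a basis of the `R`-module `Der R`.  The `R`-linear map `α` is obtained by repeated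
application of the substitution
`1 # T = ∑_u ∑ (T_i)₁ · r_u # T(i, b_u, (T_i)₂)`, where `∑ r_u b_u` is the label of the
non root node `i` of `T`: it is invariant under every such substitution, and it is the identity on
trees whose labels are basis elements. -/
structure IsRelabeling {ι : Type*} (ψ : KLT k (Derivation k R R) →ₗ[k] Module.End k R)
    (b : Module.Basis ι R (Derivation k R R))
    (α : Smash k R (Derivation k R R) →ₗ[R] Smash k R ι) : Prop where
  subst : ∀ (T : OTree (Derivation k R R)) (i : T.Node),
    α (1 ⊗ₜ tree T) =
      α ((b.repr i.label).sum fun u r => (i.sub.splits.map fun p =>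
        ψ (tree p.1) r ⊗ₜ[k] tree (i.replace (b u) p.2)).sum)
  basis : ∀ T : OTree ι, α (1 ⊗ₜ tree (T.map b)) = 1 ⊗ₜ tree T

end Leibnitz

end

-- The map is a normal form, `relabelTree`: expand the labels recursively in the basis and move each
-- coefficient `r` past the subtree `C` below it, as `∑ (C₁ · r) • C₂`; `graft` performs one such
-- step. Every element agrees with its normal form modulo the basis substitutions
-- (`sub_ofBasis_relabel_mem`), and a substitution-invariant map kills that difference, so
-- uniqueness follows (`eq_relabel`). Invariance under all substitutions rests on `act_relabel`:
-- normalizing does not change the action on `R`, because the Leibnitz condition says that the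
-- generators of the ideal act by zero. Normalizing also commutes with the coproduct
-- (`smashComul_relabel_tree`), so a scalar can be moved past `C` before or after `C` is normalized.
-- Hence the kernel is exactly the Leibnitz ideal (`leibnitzIdeal_eq_ker`). For products, linking
-- into a grafted tree obeys the same recursion as linking into a tree with a first child
-- (`innerAct_graft` against `innerSum_cons`), so products of trees are compared by induction on the
-- right factor, and scalars in between are handled by `act_relabel`. The antiproduct is determined
-- by product and coproduct: `transl`, that is `(x, y) ↦ ∑ x₁ ⊗ σ(x₂) y`, inverts the Galois map `x
-- ⊗ w ↦ ∑ x₁ ⊗ x₂ w`, and the antiproduct of `x` is its value at `(x, 1)`. The defining equation is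
-- triangular for the number of children of the root, so its solution is unique and is respected by
-- the normal form. The ideal is then a Hopf ideal as the kernel of a surjective Hopf homomorphism.
-- Sums over coproduct and product terms are treated as functionals (`splitSum`, `prodSum`), so the
-- order in which the terms are listed never matters.

universe v

/-! ### Combinatorics of the coproduct and product of trees. -/

namespace OTree

theorem list_sum_map_comm {α β M : Type*} [AddCommMonoid M] (l : List α) (m : List β)
    (f : α → β → M) :
    (l.map fun a => (m.map fun b => f a b).sum).sum =
      (m.map fun b => (l.map fun a => f a b).sum).sum := by
  induction l with
  | nil => simp
  | cons a l ih => simp [ih, List.sum_map_add]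

theorem list_sum_flatMap_map {α β M : Type*} [AddCommMonoid M] (l : List α) (g : α → List β)
    (f : β → M) :
    ((l.flatMap g).map f).sum = (l.map fun a => ((g a).map f).sum).sum := by
  induction l with
  | nil => simp
  | cons a l ih => simp [ih]

section Sums

variable {S : Type*} {M : Type*} [AddCommMonoid M]

/-- The sum of `f T₁ T₂` over the terms `T₁ ⊗ T₂` of the coproduct of `T`. -/
def splitSum (T : OTree S) (f : OTree S → OTree S → M) : M :=
  (T.splits.map fun p => f p.1 p.2).sum

/-- The sum of `f X` over the trees obtained by linking the children of the root of `T` to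
non root nodes of `G`. -/
def innerSum (T G : OTree S) (f : OTree S → M) : M := ((inner T G).map f).sum

/-- The sum of `f X` over the terms of the product of `T` and `G`. -/
def prodSum (T G : OTree S) (f : OTree S → M) : M := ((prod T G).map f).sum

/-- `m` multiplied by the counit of `T`. -/
def eps : OTree S → M → M
  | one, m => m
  | cons _ _ _, _ => 0

@[simp] theorem eps_one (m : M) : eps (one : OTree S) m = m := rfl

@[simp] theorem eps_cons (E : S) (C F : OTree S) (m : M) : eps (cons E C F) m = 0 := rfl

@[simp] theorem eps_zero (T : OTree S) : eps T (0 : M) = 0 := by cases T <;> rfl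

@[simp] theorem join_one (T : OTree S) : join T one = T := by
  induction T with
  | one => rfl
  | cons E C F _ ih => simp [join, ih]

@[simp] theorem one_join (T : OTree S) : join one T = T := rfl

theorem join_assoc (A B C : OTree S) : join (join A B) C = join A (join B C) := by
  induction A with
  | one => rfl
  | cons E C F _ ih => simp [join, ih]

@[simp] theorem splitSum_one (f : OTree S → OTree S → M) : splitSum one f = f one one := by
  simp [splitSum, splits]

theorem splitSum_cons (E : S) (C F : OTree S) (f : OTree S → OTree S → M) :
    splitSum (cons E C F) f =
      splitSum F (fun a b => f (cons E C a) b) + splitSum F (fun a b => f a (cons E C b)) := by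
  simp [splitSum, splits, Function.comp_def]

theorem splitSum_add (T : OTree S) (f g : OTree S → OTree S → M) :
    splitSum T (fun a b => f a b + g a b) = splitSum T f + splitSum T g :=
  List.sum_map_add

theorem innerSum_add (T G : OTree S) (f g : OTree S → M) :
    innerSum T G (fun X => f X + g X) = innerSum T G f + innerSum T G g :=
  List.sum_map_add

theorem prodSum_add (T G : OTree S) (f g : OTree S → M) :
    prodSum T G (fun X => f X + g X) = prodSum T G f + prodSum T G g :=
  List.sum_map_add

@[simp] theorem splitSum_zero (T : OTree S) : splitSum T (fun _ _ => (0 : M)) = 0 := by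
  simp [splitSum]

@[simp] theorem innerSum_zero (T G : OTree S) : innerSum T G (fun _ => (0 : M)) = 0 := by
  simp [innerSum]

section map

variable {N F : Type*} [AddCommMonoid N] [FunLike F M N] [AddMonoidHomClass F M N]

theorem map_splitSum (φ : F) (T : OTree S) (f : OTree S → OTree S → M) :
    φ (splitSum T f) = splitSum T fun a b => φ (f a b) := by
  simp [splitSum, map_list_sum, Function.comp_def]

theorem map_innerSum (φ : F) (T G : OTree S) (f : OTree S → M) :
    φ (innerSum T G f) = innerSum T G fun X => φ (f X) := by
  simp [innerSum, map_list_sum, Function.comp_def]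

theorem map_prodSum (φ : F) (T G : OTree S) (f : OTree S → M) :
    φ (prodSum T G f) = prodSum T G fun X => φ (f X) := by
  simp [prodSum, map_list_sum, Function.comp_def]

theorem map_eps (φ : F) (T : OTree S) (m : M) : φ (eps T m) = eps T (φ m) := by
  cases T <;> simp

end map

theorem splitSum_comm {S' : Type*} (T : OTree S) (G : OTree S')
    (f : OTree S → OTree S → OTree S' → OTree S' → M) :
    splitSum T (fun a b => splitSum G fun c d => f a b c d) =
      splitSum G fun c d => splitSum T fun a b => f a b c d :=
  list_sum_map_comm _ _ _

theorem innerSum_splitSum_comm (T G K : OTree S) (f : OTree S → OTree S → OTree S → M) :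
    innerSum T G (fun X => splitSum K fun a b => f X a b) =
      splitSum K fun a b => innerSum T G fun X => f X a b :=
  list_sum_map_comm _ _ _

theorem prodSum_splitSum_comm (T G K : OTree S) (f : OTree S → OTree S → OTree S → M) :
    prodSum T G (fun X => splitSum K fun a b => f X a b) =
      splitSum K fun a b => prodSum T G fun X => f X a b :=
  list_sum_map_comm _ _ _

theorem innerSum_comm (T G T' G' : OTree S) (f : OTree S → OTree S → M) :
    innerSum T G (fun X => innerSum T' G' fun Y => f X Y) =
      innerSum T' G' fun Y => innerSum T G fun X => f X Y :=
  list_sum_map_comm _ _ _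

theorem prodSum_innerSum_comm (T G T' G' : OTree S) (f : OTree S → OTree S → M) :
    prodSum T G (fun X => innerSum T' G' fun Y => f X Y) =
      innerSum T' G' fun Y => prodSum T G fun X => f X Y :=
  list_sum_map_comm _ _ _

theorem splitSum_swap (T : OTree S) (f : OTree S → OTree S → M) :
    splitSum T (fun a b => f b a) = splitSum T f := by
  induction T generalizing f with
  | one => simp
  | cons E C F _ ih =>
    rw [splitSum_cons, splitSum_cons, ih (fun a b => f a (cons E C b)),
      ih (fun a b => f (cons E C a) b), add_comm]

theorem splitSum_assoc (T : OTree S) (g : OTree S → OTree S → OTree S → M) :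
    splitSum T (fun a b => splitSum a fun c d => g c d b) =
      splitSum T fun a b => splitSum b fun c d => g a c d := by
  induction T generalizing g with
  | one => simp
  | cons E C F _ ih =>
    simp only [splitSum_cons, splitSum_add]
    rw [ih (fun c d b => g (cons E C c) d b), ih (fun c d b => g c (cons E C d) b),
      ih (fun c d b => g c d (cons E C b)), add_assoc]

theorem splitSum_swap_middle (T : OTree S) (g : OTree S → OTree S → OTree S → OTree S → M) :
    splitSum T (fun a b => splitSum a fun c d => splitSum b fun e f => g c d e f) =
      splitSum T fun a b => splitSum a fun c d => splitSum b fun e f => g c e d f := by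
  induction T generalizing g with
  | one => simp
  | cons E C F _ ih =>
    simp only [splitSum_cons, splitSum_add]
    rw [ih (fun c d e f => g (cons E C c) d e f), ih (fun c d e f => g c (cons E C d) e f),
      ih (fun c d e f => g c d (cons E C e) f), ih (fun c d e f => g c d e (cons E C f))]
    abel

theorem splitSum_eps (T : OTree S) (f : OTree S → M) :
    splitSum T (fun a b => eps a (f b)) = f T := by
  induction T generalizing f with
  | one => simp
  | cons E C F _ ih => simp [splitSum_cons, ih (fun b => f (cons E C b))]

theorem splitSum_eps_right (T : OTree S) (f : OTree S → M) :
    splitSum T (fun a b => eps b (f a)) = f T := by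
  rw [splitSum_swap T fun a b => eps a (f b), splitSum_eps]

theorem splitSum_join (A B : OTree S) (f : OTree S → OTree S → M) :
    splitSum (join A B) f =
      splitSum A fun a a' => splitSum B fun b b' => f (join a b) (join a' b') := by
  induction A generalizing f with
  | one => simp
  | cons E C F _ ih => simp [join, splitSum_cons, ih]

theorem innerSum_one (T : OTree S) (f : OTree S → M) : innerSum T one f = eps T (f one) := by
  cases T <;> simp [innerSum, inner]

theorem prodSum_eq (T G : OTree S) (f : OTree S → M) :
    prodSum T G f = splitSum T fun a b => innerSum b G fun X => f (join a X) := by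
  simp [prodSum, prod, splitSum, innerSum, list_sum_flatMap_map, Function.comp_def]

/-- The basic recursion: a child linked to the first child or below it is linked to an arbitrary
node of `C`, which is a product with `C`; the others go to non root nodes of `F`. -/
theorem innerSum_cons (T : OTree S) (E : S) (C F : OTree S) (f : OTree S → M) :
    innerSum T (cons E C F) f =
      splitSum T fun a b => prodSum a C fun X => innerSum b F fun Y => f (cons E X Y) := by
  have : inner T (cons E C F) = (splits T).flatMap fun p => (splits p.1).flatMap fun q =>
      (inner q.2 C).flatMap fun C' => (inner p.2 F).map fun F' => cons E (join q.1 C') F' := by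
    cases T <;> rfl
  simp [prodSum_eq, innerSum, this, splitSum, list_sum_flatMap_map, Function.comp_def]

theorem one_innerSum (G : OTree S) (f : OTree S → M) : innerSum one G f = f G := by
  induction G generalizing f with
  | one => simp [innerSum_one]
  | cons E C F ih1 ih2 => simp [innerSum_cons, prodSum_eq, ih1, ih2]

theorem one_prodSum (G : OTree S) (f : OTree S → M) : prodSum one G f = f G := by
  simp [prodSum_eq, one_innerSum]

theorem prodSum_one (G : OTree S) (f : OTree S → M) : prodSum G one f = f G := by
  simp [prodSum_eq, innerSum_one, splitSum_eps_right G f]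

theorem innerSum_join (T G K : OTree S) (f : OTree S → M) :
    innerSum T (join G K) f =
      splitSum T fun a b => innerSum a G fun X => innerSum b K fun Y => f (join X Y) := by
  induction G generalizing T f with
  | one => simp [innerSum_one, splitSum_eps T fun b => innerSum b K f]
  | cons E C F _ ih =>
    simp only [join, innerSum_cons, ih]
    simp only [prodSum_splitSum_comm]
    rw [splitSum_assoc T fun c d b => prodSum c C fun X => innerSum d F fun Y =>
      innerSum b K fun Z => f (cons E X (join Y Z))]

theorem splitSum_congr (T : OTree S) {f g : OTree S → OTree S → M} (h : ∀ a b, f a b = g a b) :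
    splitSum T f = splitSum T g := by
  rw [funext₂ h]

theorem innerSum_congr (T G : OTree S) {f g : OTree S → M} (h : ∀ X, f X = g X) :
    innerSum T G f = innerSum T G g := by
  rw [funext h]

theorem prodSum_congr (T G : OTree S) {f g : OTree S → M} (h : ∀ X, f X = g X) :
    prodSum T G f = prodSum T G g := by
  rw [funext h]

theorem splitSum_left_comm (T : OTree S) (g : OTree S → OTree S → OTree S → M) :
    splitSum T (fun a b => splitSum b fun c d => g a c d) =
      splitSum T fun a b => splitSum b fun c d => g c a d := by
  rw [← splitSum_assoc, ← splitSum_assoc T fun a c d => g c a d]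
  exact splitSum_congr T fun a b => (splitSum_swap a fun c d => g c d b).symm

/-- Linking to non root nodes leaves the children of the root of `G` in place, so splitting them
also splits the children of `T` according to the side on which they were linked. -/
theorem innerSum_splitSum (T G : OTree S) (f : OTree S → OTree S → M) :
    innerSum T G (fun X => splitSum X f) =
      splitSum T fun a b => splitSum G fun c d =>
        innerSum a c fun X => innerSum b d fun Y => f X Y := by
  induction G generalizing T f with
  | one => simp [innerSum_one, splitSum_eps T fun b => eps b (f one one)]
  | cons E C F _ ih =>
    simp only [innerSum_cons, splitSum_cons, innerSum_add, prodSum_add, splitSum_add, ih,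
      prodSum_splitSum_comm, innerSum_splitSum_comm]
    refine congrArg₂ (· + ·) ?_ ?_
    · rw [← splitSum_assoc T fun a c d => splitSum F fun e g => prodSum a C fun X =>
        innerSum c e fun Y => innerSum d g fun Z => f (cons E X Y) Z]
      exact splitSum_congr T fun a b => splitSum_comm _ _ _
    · rw [splitSum_left_comm T fun a c d => splitSum F fun e g => prodSum a C fun X =>
        innerSum c e fun Y => innerSum d g fun Z => f Y (cons E X Z)]
      refine splitSum_congr T fun a b => ?_
      rw [splitSum_comm]
      exact splitSum_congr F fun c d => splitSum_congr b fun b' b'' => prodSum_innerSum_comm ..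

theorem prodSum_splitSum (T G : OTree S) (f : OTree S → OTree S → M) :
    prodSum T G (fun X => splitSum X f) =
      splitSum T fun a b => splitSum G fun c d =>
        prodSum a c fun X => prodSum b d fun Y => f X Y := by
  simp only [prodSum_eq, splitSum_join, innerSum_splitSum_comm, innerSum_splitSum]
  rw [splitSum_swap_middle T fun c d e e' => splitSum G fun g h =>
    innerSum e g fun X => innerSum e' h fun Y => f (join c X) (join d Y)]
  refine splitSum_congr T fun a b => ?_
  rw [splitSum_comm G a]
  refine splitSum_congr a fun a' a'' => ?_
  rw [splitSum_comm G b]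

theorem prodSum_comm (T G T' G' : OTree S) (f : OTree S → OTree S → M) :
    prodSum T G (fun X => prodSum T' G' fun Y => f X Y) =
      prodSum T' G' fun Y => prodSum T G fun X => f X Y :=
  list_sum_map_comm _ _ _

/-- Associativity is reduced to the statement about non root nodes for one fixed `K`, so that it is
available for the subtree `C` inside the induction that proves that statement. -/
theorem prodSum_assoc_of_innerSum (K : OTree S)
    (hK : ∀ (T G : OTree S) (f : OTree S → M),
      innerSum G K (fun X => innerSum T X f) = prodSum T G fun Y => innerSum Y K f)
    (T G : OTree S) (f : OTree S → M) :
    prodSum G K (fun X => prodSum T X f) = prodSum T G fun Y => prodSum Y K f := by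
  have h₁ : prodSum G K (fun X => prodSum T X f) = splitSum T fun a b => splitSum b fun c d =>
      splitSum G fun g h => innerSum c g fun Y => prodSum d h fun W => innerSum W K fun Z =>
        f (join (join a Y) Z) := by
    simp only [prodSum_eq G K, prodSum_eq T, innerSum_join, innerSum_splitSum_comm]
    rw [splitSum_comm]
    refine splitSum_congr T fun a b => ?_
    rw [splitSum_comm]
    refine splitSum_congr b fun c d => splitSum_congr G fun g h => ?_
    rw [innerSum_comm]
    simp only [join_assoc]
    -- The children of `T` fall into three groups: linked to the root, to non root nodes of the part
    -- `g` of `G` that stays at the root, or to non root nodes of the rest; only the last group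
    -- needs `hK`.
    exact innerSum_congr _ _ fun Y => hK d h fun Z => f (join a (join Y Z))
  rw [h₁]
  simp only [prodSum_eq _ K]
  rw [prodSum_splitSum, ← splitSum_assoc T fun a c d =>
      splitSum G fun g h => innerSum c g fun Y => prodSum d h fun W => innerSum W K fun Z =>
        f (join (join a Y) Z)]
  refine splitSum_congr T fun a b => ?_
  rw [splitSum_comm]
  exact splitSum_congr G fun g h => (prodSum_eq a g fun U => prodSum b h fun W =>
    innerSum W K fun Z => f (join U Z)).symm

theorem eps_join (T G : OTree S) (m : M) : eps (join T G) m = eps T (eps G m) := by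
  cases T <;> simp [join]

theorem innerSum_eps (T G : OTree S) (m : M) :
    innerSum T G (fun X => eps X m) = eps T (eps G m) := by
  cases G <;> simp [innerSum_one, innerSum_cons, prodSum]

theorem prodSum_eps (T G : OTree S) (m : M) :
    prodSum T G (fun X => eps X m) = eps T (eps G m) := by
  have h (a b : OTree S) : innerSum b G (fun X => eps a (eps X m)) = eps a (eps b (eps G m)) := by
    cases a <;> simp [innerSum_eps]
  simp [prodSum_eq, eps_join, h, splitSum_eps T fun b => eps b (eps G m)]

/-- After `G` has been linked below the root of `K`, a child of `T` linked to a non root node goes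
either to a node of `G` or directly to a non root node of `K`. Multiplying `T` with `G` first
records the same choice. -/
theorem innerSum_innerSum (T G K : OTree S) (f : OTree S → M) :
    innerSum G K (fun X => innerSum T X f) = prodSum T G fun Y => innerSum Y K f := by
  induction K generalizing T G f with
  | one =>
    simp only [innerSum_one, prodSum_eps]
    cases T <;> cases G <;> simp
  | cons E C F ihC ihF =>
    simp only [innerSum_cons, prodSum_splitSum, innerSum_splitSum_comm, prodSum_splitSum_comm]
    rw [splitSum_comm]
    refine splitSum_congr T fun a b => splitSum_congr G fun c d => ?_
    -- Full associativity on `C`, obtained from `ihC`, and the non root version on `F`, given by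
    -- `ihF`.
    have h : ∀ g : OTree S → OTree S → M,
        (prodSum a c fun W => prodSum b d fun Z => prodSum W C fun U => innerSum Z F fun V =>
          g U V) = prodSum c C fun X => innerSum d F fun Y => prodSum a X fun U =>
            innerSum b Y fun V => g U V := by
      intro g
      simp only [prodSum_comm b d, ← ihF]
      rw [← prodSum_assoc_of_innerSum C ihC]
      exact prodSum_congr _ _ fun X => prodSum_innerSum_comm _ _ _ _ _
    exact (h _).symm

theorem prodSum_assoc (T G K : OTree S) (f : OTree S → M) :
    prodSum G K (fun X => prodSum T X f) = prodSum T G fun Y => prodSum Y K f :=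
  prodSum_assoc_of_innerSum K (fun T G f => innerSum_innerSum T G K f) T G f

end Sums
end OTree

/-! ### Grading by the children of the root, convolution equations, change of labels. -/

namespace OTree

section Degree

variable {S : Type*}

/-- The number of children of the root. -/
def rootDegree : OTree S → ℕ
  | one => 0
  | cons _ _ F => rootDegree F + 1

@[simp] theorem rootDegree_one : rootDegree (one : OTree S) = 0 := rfl

@[simp] theorem rootDegree_cons (E : S) (C F : OTree S) :
    rootDegree (cons E C F) = rootDegree F + 1 := rfl

theorem splitSum_congr_rootDegree {M : Type*} [AddCommMonoid M] (T : OTree S)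
    {f g : OTree S → OTree S → M}
    (h : ∀ a b, rootDegree a + rootDegree b = rootDegree T → f a b = g a b) :
    splitSum T f = splitSum T g := by
  induction T generalizing f g with
  | one => simpa using h one one rfl
  | cons E C F _ ih =>
    rw [splitSum_cons, splitSum_cons]
    refine congrArg₂ (· + ·) (ih fun a b hab => h _ _ ?_) (ih fun a b hab => h _ _ ?_) <;>
      simp only [rootDegree_cons] <;> omega

/-- The term `T ⊗ 1` is the only one whose left factor has full root degree. This is the form in
which connectedness enters the inductions below. -/
theorem splitSum_eq_of_rootDegree_lt {M : Type*} [AddCommMonoid M] (T : OTree S)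
    {f : OTree S → OTree S → M} (h : ∀ a b, rootDegree a < rootDegree T → f a b = 0) :
    splitSum T f = f T one := by
  rw [← splitSum_eps_right T fun a => f a one]
  refine splitSum_congr_rootDegree T fun a b hab => ?_
  cases b with
  | one => rfl
  | cons E C F => exact h _ _ (by simp only [rootDegree_cons] at hab; omega)

theorem rootDegree_induction {P : OTree S → Prop}
    (h : ∀ T, (∀ a, rootDegree a < rootDegree T → P a) → P T) (T : OTree S) : P T :=
  WellFounded.induction (measure rootDegree).wf T h

section Convolution

variable {M : Type*} [AddCommGroup M]

theorem splitSum_sub (T : OTree S) (f g : OTree S → OTree S → M) :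
    splitSum T (fun a b => f a b - g a b) = splitSum T f - splitSum T g :=
  eq_sub_of_add_eq (by rw [← splitSum_add]; simp)

/-- Successive approximations to the solution `u` of `∑ op (u T₁) T₂ = e T`. -/
def convSolveAux (op : M → OTree S → M) (e : OTree S → M) : ℕ → OTree S → M
  | 0, T => e T
  | n + 1, T => e T - splitSum T fun a b =>
      op (convSolveAux op e n a) b - eps b (op (convSolveAux op e n a) b)

/-- The correction vanishes for `b = one`, so an approximation at `T` only uses left factors of
smaller root degree, and the iteration is stationary from step `rootDegree T` on. -/
theorem convSolveAux_stable (op : M → OTree S → M) (e : OTree S → M) (n m : ℕ) (T : OTree S)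
    (hn : rootDegree T ≤ n) (hm : rootDegree T ≤ m) :
    convSolveAux op e n T = convSolveAux op e m T := by
  have hone (n : ℕ) : convSolveAux op e n one = e one := by cases n <;> simp [convSolveAux]
  cases T with
  | one => rw [hone, hone]
  | cons E C F =>
    induction n generalizing m E C F with
    | zero => simp at hn
    | succ n ih =>
      cases m with
      | zero => simp at hm
      | succ m =>
        refine congrArg _ (splitSum_congr_rootDegree _ fun a b hab => ?_)
        cases b with
        | one => simp
        | cons E' C' F' =>
          cases a with
          | one => rw [hone, hone]
          | cons E'' C'' F'' =>
            simp only [rootDegree_cons] at hab hn hm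
            rw [ih m E'' C'' F'' (by simp; omega) (by simp; omega)]

/-- Convolution equations are solvable in the connected coalgebra of trees. -/
theorem exists_splitSum_eq (op : M → OTree S → M) (hop : ∀ x, op x one = x) (e : OTree S → M) :
    ∃ u : OTree S → M, ∀ T, splitSum T (fun a b => op (u a) b) = e T := by
  refine ⟨fun T => convSolveAux op e (rootDegree T) T, fun T => ?_⟩
  have h := convSolveAux_stable op e _ (rootDegree T + 1) T le_rfl (Nat.le_succ _)
  have h' : convSolveAux op e (rootDegree T + 1) T = e T - splitSum T fun a b =>
      op (convSolveAux op e (rootDegree a) a) b -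
        eps b (op (convSolveAux op e (rootDegree a) a) b) := by
    refine congrArg _ (splitSum_congr_rootDegree _ fun a b hab => ?_)
    rw [convSolveAux_stable op e (rootDegree T) (rootDegree a) a (by omega) le_rfl]
  have h'' (x : OTree S → OTree S → M) : splitSum T (fun a b => eps b (x a b)) = x T one := by
    rw [← splitSum_eps_right T fun a => x a one]
    exact splitSum_congr T fun a b => by cases b <;> rfl
  rw [h', splitSum_sub, h'', hop] at h
  rw [eq_sub_iff_add_eq, add_sub_cancel] at h
  exact h

end Convolution

end Degree

section Map

variable {S S' : Type*} {M : Type*} [AddCommMonoid M] (f : S → S')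

theorem join_map (T G : OTree S) : (join T G).map f = join (T.map f) (G.map f) := by
  induction T with
  | one => rfl
  | cons E C F _ ih => simp [join, map, ih]

theorem eps_map (T : OTree S) (m : M) : eps (T.map f) m = eps T m := by cases T <;> rfl

theorem splitSum_map (T : OTree S) (g : OTree S' → OTree S' → M) :
    splitSum (T.map f) g = splitSum T fun a b => g (a.map f) (b.map f) := by
  induction T generalizing g with
  | one => simp [map]
  | cons E C F _ ih => simp [map, splitSum_cons, ih]

theorem innerSum_map (T G : OTree S) (g : OTree S' → M) :
    innerSum (T.map f) (G.map f) g = innerSum T G fun X => g (X.map f) := by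
  induction G generalizing T g with
  | one => simp [map, innerSum_one, eps_map]
  | cons E C F ih1 ih2 =>
    simp [map, innerSum_cons, prodSum_eq, splitSum_map, ih1, ih2, join_map]

theorem prodSum_map (T G : OTree S) (g : OTree S' → M) :
    prodSum (T.map f) (G.map f) g = prodSum T G fun X => g (X.map f) := by
  simp [prodSum_eq, splitSum_map, innerSum_map, join_map]

end Map

end OTree

open OTree

/-! ### The Hopf algebra of trees and its antipode. -/

namespace KLT

variable {k : Type*} [Field k] {S S' : Type*}

theorem mul_tree (T G : OTree S) : mul (tree T : KLT k S) (tree G) = prodSum T G tree := by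
  simp [mul, tree, prodSum]

theorem comul_tree (T : OTree S) :
    comul (tree T : KLT k S) = splitSum T fun a b => tree a ⊗ₜ[k] tree b := by
  simp [comul, tree, splitSum]

theorem counit_tree (T : OTree S) : counit (tree T : KLT k S) = eps T 1 := by
  cases T <;> simp [counit, tree]

theorem mapLabel_tree (f : S → S') (T : OTree S) :
    mapLabel f (tree T : KLT k S) = tree (T.map f) := by
  simp [mapLabel, tree]

theorem linearMap_ext {M : Type*} [AddCommMonoid M] [Module k M] {f g : KLT k S →ₗ[k] M}
    (h : ∀ T, f (tree T) = g (tree T)) : f = g :=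
  Finsupp.lhom_ext' fun T => LinearMap.ext_ring (h T)

/-- The linear map with given values on trees. -/
noncomputable def ofTree {M : Type*} [AddCommMonoid M] [Module k M] (f : OTree S → M) :
    KLT k S →ₗ[k] M := Finsupp.linearCombination k f

@[simp] theorem ofTree_tree {M : Type*} [AddCommMonoid M] [Module k M] (f : OTree S → M)
    (T : OTree S) : (ofTree f : KLT k S →ₗ[k] M) (tree T) = f T := by
  simp [ofTree, tree]

theorem one_mul (x : KLT k S) : mul (tree one) x = x :=
  LinearMap.congr_fun (linearMap_ext (g := LinearMap.id) fun T => by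
    simp [mul_tree, one_prodSum]) x

theorem mul_one (x : KLT k S) : mul x (tree one) = x :=
  LinearMap.congr_fun (linearMap_ext (f := mul.flip (tree one)) (g := LinearMap.id) fun T => by
    simp [mul_tree, prodSum_one]) x

theorem mul_assoc (x y z : KLT k S) : mul (mul x y) z = mul x (mul y z) := by
  have h : (LinearMap.llcomp k (KLT k S) (KLT k S) (KLT k S)).compl₁₂ mul mul =
      mul.compr₂ mul := by
    refine linearMap_ext fun T => linearMap_ext fun G => linearMap_ext fun K => ?_
    simp only [LinearMap.compl₁₂_apply, LinearMap.llcomp_apply, LinearMap.compr₂_apply, mul_tree,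
      map_prodSum]
    refine Eq.trans ?_ (map_prodSum (LinearMap.applyₗ (tree K : KLT k S)) T G
      fun X => mul (tree X)).symm
    simp only [LinearMap.applyₗ_apply_apply, mul_tree]
    exact prodSum_assoc T G K tree
  exact (LinearMap.congr_fun (LinearMap.congr_fun (LinearMap.congr_fun h x) y) z).symm

/-- The identity has a left convolution inverse `u` and a right one `v`, since convolution equations
are solvable; they coincide by associativity of the convolution `u * id * v`. -/
theorem exists_isAntipode : ∃ σ : KLT k S →ₗ[k] KLT k S, IsAntipode σ := by
  obtain ⟨u, hu⟩ := exists_splitSum_eq (fun (x : KLT k S) b => mul x (tree b)) mul_one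
    fun T : OTree S => eps T (tree one)
  obtain ⟨v, hv⟩ := exists_splitSum_eq (fun (x : KLT k S) b => mul (tree b) x) one_mul
    fun T : OTree S => eps T (tree one)
  have hv' (T : OTree S) : splitSum T (fun a b => mul (tree a) (v b)) = eps T (tree one) := by
    rw [← hv, splitSum_swap T fun a b => mul (tree b) (v a)]
  have huv (T : OTree S) : u T = v T := by
    have h := splitSum_assoc T fun a b c => mul (mul (u a) (tree b)) (v c)
    have h1 (a b : OTree S) : splitSum a (fun c d => mul (mul (u c) (tree d)) (v b)) =
        eps a (v b) := by
      refine (map_splitSum (mul.flip (v b)) a fun c d => mul (u c) (tree d)).symm.trans ?_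
      rw [hu, map_eps, LinearMap.flip_apply, one_mul]
    have h2 (a b : OTree S) : splitSum b (fun c d => mul (mul (u a) (tree c)) (v d)) =
        eps b (u a) := by
      simp only [mul_assoc]
      rw [← map_splitSum (mul (u a)) b fun c d => mul (tree c) (v d), hv', map_eps, mul_one]
    simp only [h1, h2, splitSum_eps, splitSum_eps_right T u] at h
    exact h.symm
  have heps (T : OTree S) : (eps T (1 : k)) • (tree one : KLT k S) = eps T (tree one) := by
    cases T <;> simp
  refine ⟨ofTree u, fun h => ⟨?_, ?_⟩⟩
  · refine LinearMap.congr_fun (linearMap_ext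
      (f := TensorProduct.lift (mul.compl₁₂ (ofTree u) LinearMap.id) ∘ₗ comul)
      (g := counit.smulRight (tree one)) fun T => ?_) h
    simp [comul_tree, counit_tree, map_splitSum, hu, heps]
  · refine LinearMap.congr_fun (linearMap_ext
      (f := TensorProduct.lift (mul.compl₁₂ LinearMap.id (ofTree u)) ∘ₗ comul)
      (g := counit.smulRight (tree one)) fun T => ?_) h
    simp [comul_tree, counit_tree, map_splitSum, huv, hv', heps]

theorem IsAntipode.splitSum_mul {σ : KLT k S →ₗ[k] KLT k S} (hσ : IsAntipode σ) (T : OTree S) :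
    splitSum T (fun a b => mul (σ (tree a)) (tree b)) = eps T (tree one) := by
  have h := (hσ (tree T)).1
  simp only [comul_tree, map_splitSum, counit_tree] at h
  simp only [TensorProduct.lift.tmul, LinearMap.compl₁₂_apply, LinearMap.id_apply] at h
  rw [h]
  cases T <;> simp

end KLT

/-! ### Module algebra actions on `R`. -/

namespace IsModuleAlgebra

variable {k : Type*} [Field k] {R : Type*} [CommRing R] [Algebra k R] {S S' : Type*}
  {ψ : KLT k S →ₗ[k] Module.End k R} (hψ : IsModuleAlgebra ψ)

include hψ

theorem act_prodSum (T G : OTree S) (r : R) :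
    ψ (KLT.tree T) (ψ (KLT.tree G) r) = prodSum T G fun X => ψ (KLT.tree X) r := by
  rw [← hψ.mul_act, KLT.mul_tree]
  exact map_prodSum (ψ.flip r) T G KLT.tree

theorem act_splitSum (T : OTree S) (r s : R) :
    ψ (KLT.tree T) (r * s) = splitSum T fun a b => ψ (KLT.tree a) r * ψ (KLT.tree b) s := by
  simp [hψ.act_mul, KLT.comul_tree, map_splitSum]

/-- By induction on the root degree, all proper terms in `T · (1 * 1)` vanish when `T` is not the
unit, leaving `T · 1 = T · 1 + T · 1`. -/
theorem act_one (T : OTree S) : ψ (KLT.tree T) 1 = eps T 1 := by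
  induction T using rootDegree_induction with
  | h T ih =>
    cases T with
    | one => exact hψ.one_act 1
    | cons E C F =>
      have h := hψ.act_splitSum (cons E C F) 1 1
      rw [splitSum_congr_rootDegree (g := fun a b => eps a (ψ (KLT.tree b) 1) +
        eps b (ψ (KLT.tree a) 1)), splitSum_add, splitSum_eps,
        splitSum_eps_right _ fun a => ψ (KLT.tree a) 1] at h
      · simpa using h
      · intro a b hab
        cases a with
        | one =>
          cases b with
          | one => simp at hab
          | cons => simp [hψ.one_act]
        | cons E' C' F' =>
          cases b with
          | one => simp [hψ.one_act]
          | cons E'' C'' F'' =>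
            rw [ih (cons E' C' F') (by simp only [rootDegree_cons] at hab ⊢; omega)]
            simp

end IsModuleAlgebra

theorem IsModuleAlgebra.comp_mapLabel {k : Type*} [Field k] {R : Type*} [CommRing R] [Algebra k R]
    {S S' : Type*} {ψ : KLT k S →ₗ[k] Module.End k R} (hψ : IsModuleAlgebra ψ) (f : S' → S) :
    IsModuleAlgebra (ψ ∘ₗ KLT.mapLabel f) where
  one_act r := by simp [KLT.mapLabel_tree, OTree.map, hψ.one_act]
  mul_act g h r := by
    have : KLT.mul.compr₂ (KLT.mapLabel (k := k) f) =
        KLT.mul.compl₁₂ (KLT.mapLabel f) (KLT.mapLabel f) := by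
      refine KLT.linearMap_ext fun T => KLT.linearMap_ext fun G => ?_
      simp [KLT.mul_tree, KLT.mapLabel_tree, map_prodSum, prodSum_map]
    have h' := LinearMap.congr_fun (LinearMap.congr_fun this g) h
    simp only [LinearMap.compr₂_apply, LinearMap.compl₁₂_apply] at h'
    simp [h', hψ.mul_act]
  act_mul h r s := by
    refine LinearMap.congr_fun (KLT.linearMap_ext
      (f := (ψ ∘ₗ KLT.mapLabel f).flip (r * s))
      (g := LinearMap.mul' k R ∘ₗ (TensorProduct.map ((ψ ∘ₗ KLT.mapLabel f).flip r)
        ((ψ ∘ₗ KLT.mapLabel f).flip s)) ∘ₗ KLT.comul) fun T => ?_) h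
    simp [KLT.comul_tree, KLT.mapLabel_tree, map_splitSum, hψ.act_splitSum, splitSum_map]

namespace OTree

variable {S : Type*} {R M : Type*} [Semiring R] [AddCommMonoid M] [Module R M]

theorem smul_splitSum (r : R) (T : OTree S) (f : OTree S → OTree S → M) :
    r • splitSum T f = splitSum T fun a b => r • f a b :=
  map_splitSum (DistribSMul.toAddMonoidHom M r) T f

theorem splitSum_smul (T : OTree S) (f : OTree S → OTree S → R) (x : M) :
    splitSum T f • x = splitSum T fun a b => f a b • x :=
  map_splitSum (LinearMap.toSpanSingleton R M x) T f

theorem smul_innerSum (r : R) (T G : OTree S) (f : OTree S → M) :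
    r • innerSum T G f = innerSum T G fun X => r • f X :=
  map_innerSum (DistribSMul.toAddMonoidHom M r) T G f

theorem smul_prodSum (r : R) (T G : OTree S) (f : OTree S → M) :
    r • prodSum T G f = prodSum T G fun X => r • f X :=
  map_prodSum (DistribSMul.toAddMonoidHom M r) T G f

theorem prodSum_smul (T G : OTree S) (f : OTree S → R) (x : M) :
    prodSum T G f • x = prodSum T G fun X => f X • x :=
  map_prodSum (LinearMap.toSpanSingleton R M x) T G f

end OTree

/-! ### The smash product: tree basis, coalgebra structure, associative product. -/

namespace Smash

variable {k : Type*} [Field k] {R : Type*} [CommRing R] [Algebra k R] {S S' : Type*}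

variable (k R) in
/-- A tree, as an element of the smash product. -/
noncomputable abbrev tree (T : OTree S) : Smash k R S := 1 ⊗ₜ KLT.tree T

variable (k R S) in
/-- The trees form a basis of the smash product. -/
noncomputable def treeBasis : Module.Basis (OTree S) R (Smash k R S) :=
  Algebra.TensorProduct.basis R (Finsupp.basisSingleOne (R := k) (ι := OTree S))

theorem treeBasis_apply (T : OTree S) : treeBasis k R S T = tree k R T := by
  simp [treeBasis, tree, KLT.tree]

theorem tmul_tree (r : R) (T : OTree S) : r ⊗ₜ[k] KLT.tree T = r • tree k R T := by
  simp [tree, TensorProduct.smul_tmul']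

section ofTree

variable {N : Type*} [AddCommMonoid N] [Module R N]

theorem linearMap_ext {f g : Smash k R S →ₗ[R] N}
    (h : ∀ T, f (tree k R T) = g (tree k R T)) : f = g :=
  (treeBasis k R S).ext fun T => by simpa only [treeBasis_apply] using h T

theorem induction {P : Smash k R S → Prop} (zero : P 0) (add : ∀ x y, P x → P y → P (x + y))
    (smul : ∀ (r : R) x, P x → P (r • x)) (tree : ∀ T, P (tree k R T)) (x : Smash k R S) : P x := by
  have h : x ∈ Submodule.span R (Set.range (treeBasis k R S)) := by
    rw [Module.Basis.span_eq]; trivial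
  induction h using Submodule.span_induction with
  | mem x hx =>
    obtain ⟨T, rfl⟩ := hx
    rw [treeBasis_apply]
    exact tree T
  | zero => exact zero
  | add x y _ _ hx hy => exact add x y hx hy
  | smul r x _ hx => exact smul r x hx

/-- The `R`-linear map on the smash product with given values on trees. -/
noncomputable def ofTree (f : OTree S → N) : Smash k R S →ₗ[R] N := (treeBasis k R S).constr ℕ f

@[simp] theorem ofTree_tree (f : OTree S → N) (T : OTree S) :
    ofTree f (tree k R T) = f T := by
  rw [ofTree, ← treeBasis_apply, Module.Basis.constr_basis]

end ofTree

section Coalgebra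

theorem smashComul_tree (T : OTree S) :
    smashComul k R S (tree k R T) = splitSum T fun a b => tree k R a ⊗ₜ[R] tree k R b := by
  simp only [smashComul, LinearMap.comp_apply, LinearMap.baseChange_tmul, KLT.comul_tree]
  rw [← TensorProduct.mk_apply, map_splitSum, map_splitSum]
  refine splitSum_congr T fun a b => ?_
  simp [TensorProduct.AlgebraTensorModule.distribBaseChange]

theorem smashCounit_tree (T : OTree S) : smashCounit k R S (tree k R T) = eps T 1 := by
  cases T <;> simp [smashCounit, KLT.counit_tree]

variable {N : Type*} [AddCommMonoid N] [Module R N]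

theorem lift_smashComul_tree (B : Smash k R S →ₗ[R] Smash k R S →ₗ[R] N) (T : OTree S) :
    TensorProduct.lift B (smashComul k R S (tree k R T)) =
      splitSum T fun a b => B (tree k R a) (tree k R b) := by
  rw [smashComul_tree, map_splitSum]
  rfl

end Coalgebra

section Join

/-- The `R`-bilinear extension of the operation of identifying the roots of two trees. -/
noncomputable def join : Smash k R S →ₗ[R] Smash k R S →ₗ[R] Smash k R S :=
  ofTree fun a => ofTree fun b => tree k R (OTree.join a b)

@[simp] theorem join_tree_tree (T G : OTree S) :
    join (tree k R T) (tree k R G) = tree k R (OTree.join T G) := by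
  simp [join]

/-- The `R`-bilinear extension of `OTree.cons`. -/
noncomputable def cons (E : S) : Smash k R S →ₗ[R] Smash k R S →ₗ[R] Smash k R S :=
  ofTree fun C => ofTree fun F => tree k R (OTree.cons E C F)

@[simp] theorem cons_tree_tree (E : S) (C F : OTree S) :
    cons E (tree k R C) (tree k R F) = tree k R (OTree.cons E C F) := by
  simp [cons]

end Join

section Mul

variable (ψ : KLT k S →ₗ[k] Module.End k R)

/-- The action of a tree `T` on the smash product by `r # h ↦ ∑ T₁ · r # L T₂ h`. -/
noncomputable def twist (L : OTree S → Module.End k (KLT k S)) (T : OTree S) :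
    Module.End k (Smash k R S) :=
  splitSum T fun a b => TensorProduct.map (ψ (KLT.tree a)) (L b)

/-- The linking of the children of the root of `T` to the non root nodes of a tree,
extended to the smash product. -/
noncomputable def innerAct (T : OTree S) : Module.End k (Smash k R S) :=
  twist ψ (fun b => KLT.ofTree fun G => innerSum b G KLT.tree) T

theorem smashMul_tree_eq_twist (T : OTree S) :
    smashMul ψ (tree k R T) = twist ψ (fun b => KLT.mul (KLT.tree b)) T := by
  refine TensorProduct.ext' fun s g => ?_
  rw [smashMul_tmul, twist, ← LinearMap.applyₗ_apply_apply (R := k), map_splitSum]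
  simp [splitSum]

theorem smashMul_smul (r : R) (x y : Smash k R S) :
    smashMul ψ (r • x) y = r • smashMul ψ x y := by
  induction x using TensorProduct.induction_on with
  | zero => simp
  | add x z hx hz => simp only [smul_add, map_add, LinearMap.add_apply, hx, hz]
  | tmul s h =>
    have key (r : R) (z : Smash k R S) :
        LinearMap.rTensor (KLT k S) (LinearMap.mul k R r) z = r • z := by
      induction z using TensorProduct.induction_on with
      | zero => simp
      | add x y hx hy => simp only [map_add, hx, hy, smul_add]
      | tmul t g => simp [TensorProduct.smul_tmul']
    simp only [smashMul, TensorProduct.smul_tmul', TensorProduct.lift.tmul,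
      LinearMap.compl₁₂_apply, LinearMap.comp_apply, LinearMap.coe_rTensorHom, LinearMap.mul_apply',
      Module.End.mul_apply, key, smul_eq_mul, mul_smul]

variable {ψ} (hψ : IsModuleAlgebra ψ)
include hψ

/-- The operators `L` play no role beyond linearity: the rule follows from the module algebra axiom
and coassociativity. It therefore serves both the product and `innerAct`. -/
theorem twist_smul (L : OTree S → Module.End k (KLT k S)) (T : OTree S) (s : R)
    (y : Smash k R S) :
    twist ψ L T (s • y) = splitSum T fun a b => ψ (KLT.tree a) s • twist ψ L b y := by
  have key (T : OTree S) (y : Smash k R S) : twist ψ L T y =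
      splitSum T fun a b => TensorProduct.map (ψ (KLT.tree a)) (L b) y :=
    map_splitSum (LinearMap.applyₗ y) T _
  induction y using TensorProduct.induction_on with
  | zero => simp
  | add y z hy hz => simp only [smul_add, map_add, hy, hz, splitSum_add]
  | tmul t g =>
    simp only [key, TensorProduct.smul_tmul', smul_eq_mul, TensorProduct.map_tmul,
      hψ.act_splitSum, smul_splitSum]
    rw [← splitSum_assoc T fun a c d => (ψ (KLT.tree a) s * ψ (KLT.tree c) t) ⊗ₜ[k] L d g]
    refine splitSum_congr T fun a b => ?_
    exact map_splitSum ((TensorProduct.mk k R (KLT k S)).flip (L b g)) a _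

theorem twist_tree (L : OTree S → Module.End k (KLT k S)) (T G : OTree S) :
    twist ψ L T (tree k R G) = 1 ⊗ₜ L T (KLT.tree G) := by
  rw [twist, ← LinearMap.applyₗ_apply_apply (R := k), map_splitSum]
  simp only [LinearMap.applyₗ_apply_apply, TensorProduct.map_tmul, hψ.act_one]
  rw [← splitSum_eps T fun b => (1 : R) ⊗ₜ[k] L b (KLT.tree G)]
  exact splitSum_congr T fun a b => by cases a <;> simp

theorem innerAct_smul (T : OTree S) (s : R) (y : Smash k R S) :
    innerAct ψ T (s • y) = splitSum T fun a b => ψ (KLT.tree a) s • innerAct ψ b y :=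
  twist_smul hψ _ T s y

theorem innerAct_tree (T G : OTree S) :
    innerAct ψ T (tree k R G) = innerSum T G (tree k R) := by
  rw [innerAct, twist_tree hψ, KLT.ofTree_tree, ← TensorProduct.mk_apply, map_innerSum]
  rfl

theorem smashMul_tree_smul (T : OTree S) (s : R) (y : Smash k R S) :
    smashMul ψ (tree k R T) (s • y) =
      splitSum T fun a b => ψ (KLT.tree a) s • smashMul ψ (tree k R b) y := by
  simp only [smashMul_tree_eq_twist, twist_smul hψ]

theorem smashMul_tree_tree (T G : OTree S) :
    smashMul ψ (tree k R T) (tree k R G) = prodSum T G (tree k R) := by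
  rw [smashMul_tree_eq_twist, twist_tree hψ, KLT.mul_tree, ← TensorProduct.mk_apply, map_prodSum]
  rfl

/-- Each child of the root of `T` either stays at the root or is linked below it. Writing the
product through `join` and `innerAct` allows the two pieces to be compared with normal forms
separately. -/
theorem smashMul_tree_eq_splitSum (T : OTree S) (y : Smash k R S) :
    smashMul ψ (tree k R T) y = splitSum T fun a b => join (tree k R a) (innerAct ψ b y) := by
  induction y using induction generalizing T with
  | zero => simp
  | add y z hy hz => simp only [map_add, hy, hz, splitSum_add]
  | smul s y hy =>
    simp only [smashMul_tree_smul hψ, hy, innerAct_smul hψ, smul_splitSum, map_splitSum, map_smul]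
    exact splitSum_left_comm T fun a c d =>
      ψ (KLT.tree a) s • join (tree k R c) (innerAct ψ d y)
  | tree G =>
    rw [smashMul_tree_tree hψ, prodSum_eq]
    simp only [innerAct_tree hψ, map_innerSum, join_tree_tree]

/-- On trees this is `prodSum_assoc`; a scalar in `y` passes through because the coproduct is
multiplicative and `R` is a module. -/
theorem smashMul_tree_assoc (T G : OTree S) (y : Smash k R S) :
    smashMul ψ (smashMul ψ (tree k R T) (tree k R G)) y =
      smashMul ψ (tree k R T) (smashMul ψ (tree k R G) y) := by
  have key (y : Smash k R S) : smashMul ψ (smashMul ψ (tree k R T) (tree k R G)) y =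
      prodSum T G fun X => smashMul ψ (tree k R X) y := by
    rw [smashMul_tree_tree hψ]
    exact map_prodSum ((smashMul ψ).flip y) T G (tree k R)
  rw [key]
  clear key
  induction y using induction generalizing T G with
  | zero => simp [prodSum]
  | add y z hy hz => simp only [map_add, hy, hz, prodSum_add]
  | smul s y hy =>
    simp only [smashMul_tree_smul hψ, prodSum_splitSum, map_splitSum, ← hy]
    rw [splitSum_comm]
    refine splitSum_congr G fun c d => splitSum_congr T fun a b => ?_
    simp only [hψ.act_prodSum, prodSum_smul, smul_prodSum]
    exact prodSum_comm ..
  | tree K =>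
    simp only [smashMul_tree_tree hψ, map_prodSum]
    exact (prodSum_assoc T G K _).symm

theorem smashMul_tmul_assoc (g h : KLT k S) (y : Smash k R S) :
    smashMul ψ (1 ⊗ₜ KLT.mul g h) y = smashMul ψ (1 ⊗ₜ g) (smashMul ψ (1 ⊗ₜ h) y) := by
  let A : KLT k S →ₗ[k] Module.End k (Smash k R S) := smashMul ψ ∘ₗ TensorProduct.mk k R (KLT k S) 1
  have h' : KLT.mul.compr₂ A = (LinearMap.mul k _).compl₁₂ A A := by
    refine KLT.linearMap_ext fun T => KLT.linearMap_ext fun G => LinearMap.ext fun y => ?_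
    simp only [LinearMap.compr₂_apply, LinearMap.compl₁₂_apply, LinearMap.mul_apply',
      Module.End.mul_apply, A, LinearMap.comp_apply, TensorProduct.mk_apply,
      ← smashMul_tree_assoc hψ, smashMul_tree_tree hψ, KLT.mul_tree, map_prodSum]
  exact LinearMap.congr_fun (LinearMap.congr_fun (LinearMap.congr_fun h' g) h) y

theorem one_smashMul (y : Smash k R S) : smashMul ψ (tree k R one) y = y := by
  induction y using induction with
  | zero => simp
  | add y z hy hz => simp only [map_add, hy, hz]
  | smul s y hy => simp [smashMul_tree_smul hψ, hy, hψ.one_act]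
  | tree T => rw [smashMul_tree_tree hψ, one_prodSum]

theorem smashMul_one (x : Smash k R S) : smashMul ψ x (tree k R one) = x := by
  induction x using induction with
  | zero => simp
  | add y z hy hz => simp only [map_add, LinearMap.add_apply, hy, hz]
  | smul s y hy => rw [smashMul_smul, hy]
  | tree T => rw [smashMul_tree_tree hψ, prodSum_one]

end Mul

end Smash

/-! ### Grafting with labels that are linear combinations. -/

namespace Smash

variable {k : Type*} [Field k] {R : Type*} [CommRing R] [Algebra k R] {S ι : Type*}

section Graft

variable (ψ : KLT k ι →ₗ[k] Module.End k R)

/-- The result of attaching, to the root of the second tree, a new first child with label `r • u`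
and with the subtree given by the first tree, where the coefficient `r` is moved to the left. -/
noncomputable def graftSingle (u : ι) : R →+ Smash k R ι →ₗ[R] Smash k R ι →ₗ[R] Smash k R ι where
  toFun r := ofTree fun C => splitSum C fun a b => ψ (KLT.tree a) r • cons u (tree k R b)
  map_zero' := linearMap_ext fun C => by simp
  map_add' r s := linearMap_ext fun C => by simp [add_smul, splitSum_add]

/-- The result of attaching, to the root of the second tree, a new first child whose label is
a linear combination, and with the subtree given by the first tree. -/
noncomputable def graft : (ι →₀ R) →+ Smash k R ι →ₗ[R] Smash k R ι →ₗ[R] Smash k R ι :=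
  Finsupp.liftAddHom (graftSingle ψ)

theorem graft_single_tree (u : ι) (r : R) (C : OTree ι) (z : Smash k R ι) :
    graft ψ (Finsupp.single u r) (tree k R C) z =
      splitSum C fun a b => ψ (KLT.tree a) r • cons u (tree k R b) z := by
  simp only [graft, Finsupp.liftAddHom_apply_single, graftSingle, AddMonoidHom.coe_mk,
    ZeroHom.coe_mk, ofTree_tree]
  exact map_splitSum (LinearMap.applyₗ (R := R) z) C _

theorem join_cons (u : ι) (x y z : Smash k R ι) : join (cons u x y) z = cons u x (join y z) := by
  induction x using induction with
  | zero => simp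
  | add x x' hx hx' => simp only [map_add, LinearMap.add_apply, hx, hx']
  | smul s x hx => simp only [map_smul, LinearMap.smul_apply, hx]
  | tree C =>
    induction y using induction with
    | zero => simp
    | add x x' hx hx' => simp only [map_add, LinearMap.add_apply, hx, hx']
    | smul s x hx => simp only [map_smul, LinearMap.smul_apply, hx]
    | tree F =>
      induction z using induction with
      | zero => simp
      | add x x' hx hx' => simp only [map_add, hx, hx']
      | smul s x hx => simp only [map_smul, hx]
      | tree G => simp [OTree.join]

theorem join_graft (c : ι →₀ R) (x y z : Smash k R ι) :
    join (graft ψ c x y) z = graft ψ c x (join y z) := by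
  induction c using Finsupp.induction_linear with
  | zero => simp
  | add c d hc hd => simp only [map_add, LinearMap.add_apply, hc, hd]
  | single u r =>
    induction x using induction with
    | zero => simp
    | add x x' hx hx' => simp only [map_add, LinearMap.add_apply, hx, hx']
    | smul s x hx => simp only [map_smul, LinearMap.smul_apply, hx]
    | tree C =>
      simp only [graft_single_tree]
      rw [← LinearMap.flip_apply, map_splitSum]
      simp only [LinearMap.flip_apply, map_smul, join_cons]

theorem smashComul_cons (u : ι) (x y : Smash k R ι) :
    smashComul k R ι (cons u x y) = (cons u x).rTensor _ (smashComul k R ι y) +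
      (cons u x).lTensor _ (smashComul k R ι y) := by
  induction x using induction with
  | zero => simp
  | add x x' hx hx' => 
    simp only [map_add, LinearMap.add_apply, hx, hx', LinearMap.rTensor_add, LinearMap.lTensor_add]
    abel
  | smul s x hx =>
    simp only [map_smul, LinearMap.smul_apply, hx, LinearMap.rTensor_smul, LinearMap.lTensor_smul,
      smul_add]
  | tree C =>
    induction y using induction with
    | zero => simp
    | add x x' hx hx' => simp only [map_add, hx, hx']; abel
    | smul s x hx => simp only [map_smul, hx, smul_add]
    | tree F =>
      simp only [cons_tree_tree, smashComul_tree, splitSum_cons, map_splitSum,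
        LinearMap.rTensor_tmul, LinearMap.lTensor_tmul]

/-- The new child goes as a whole to one side or the other. The scalars produced by its label lie in
`R`, so they may be carried along on either factor of the tensor product over `R`. -/
theorem smashComul_graft (c : ι →₀ R) (x y : Smash k R ι) :
    smashComul k R ι (graft ψ c x y) = (graft ψ c x).rTensor _ (smashComul k R ι y) +
      (graft ψ c x).lTensor _ (smashComul k R ι y) := by
  induction c using Finsupp.induction_linear with
  | zero => simp
  | add c d hc hd =>
    simp only [map_add, LinearMap.add_apply, hc, hd, LinearMap.rTensor_add, LinearMap.lTensor_add]
    abel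
  | single u r =>
    induction x using induction with
    | zero => simp
    | add x x' hx hx' =>
      simp only [map_add, LinearMap.add_apply, hx, hx', LinearMap.rTensor_add,
        LinearMap.lTensor_add]
      abel
    | smul s x hx =>
      simp only [map_smul, LinearMap.smul_apply, hx, LinearMap.rTensor_smul,
        LinearMap.lTensor_smul, smul_add]
    | tree C =>
      have h : graft ψ (Finsupp.single u r) (tree k R C) =
          splitSum C fun a b => ψ (KLT.tree a) r • cons u (tree k R b) := by
        simp [graft, graftSingle]
      have hr (w : Smash k R ι ⊗[R] Smash k R ι)
          (f : OTree ι → OTree ι → Smash k R ι →ₗ[R] Smash k R ι) :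
          (splitSum C f).rTensor _ w = splitSum C fun a b => (f a b).rTensor _ w :=
        map_splitSum ((LinearMap.rTensorHom (R := R) _).flip w) C f
      have hl (w : Smash k R ι ⊗[R] Smash k R ι)
          (f : OTree ι → OTree ι → Smash k R ι →ₗ[R] Smash k R ι) :
          (splitSum C f).lTensor _ w = splitSum C fun a b => (f a b).lTensor _ w :=
        map_splitSum ((LinearMap.lTensorHom (R := R) _).flip w) C f
      rw [graft_single_tree, map_splitSum, h, hr, hl, ← splitSum_add]
      simp only [map_smul, smashComul_cons, smul_add, LinearMap.rTensor_smul,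
        LinearMap.lTensor_smul, LinearMap.smul_apply]

variable {ψ} (hψ : IsModuleAlgebra ψ)
include hψ

theorem graft_single_one (u : ι) : graft ψ (Finsupp.single u 1) = cons u := by
  refine linearMap_ext fun C => LinearMap.ext fun z => ?_
  rw [graft_single_tree, ← splitSum_eps C fun b => cons u (tree k R b) z]
  exact splitSum_congr C fun a b => by rw [hψ.act_one]; cases a <;> simp

theorem graft_smul_tree (r : R) (c : ι →₀ R) (C : OTree ι) (z : Smash k R ι) :
    graft ψ (r • c) (tree k R C) z =
      splitSum C fun a b => ψ (KLT.tree a) r • graft ψ c (tree k R b) z := by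
  induction c using Finsupp.induction_linear with
  | zero => simp
  | add c d hc hd => simp only [smul_add, map_add, LinearMap.add_apply, hc, hd, splitSum_add]
  | single u s =>
    simp only [Finsupp.smul_single, smul_eq_mul, graft_single_tree, hψ.act_splitSum, splitSum_smul,
      smul_splitSum, mul_smul]
    exact splitSum_assoc C fun c d b =>
      ψ (KLT.tree c) r • ψ (KLT.tree d) s • cons u (tree k R b) z

/-- The analogue of `innerSum_cons` for a grafted child. The part of `T` linked into `y` splits
again: one piece acts on the coefficient that was moved to the left, the other is linked into what
remains. Multiplicativity of the coproduct and the module axiom identify this with grafting the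
product. -/
theorem innerAct_graft (T : OTree ι) (c : ι →₀ R) (y z : Smash k R ι) :
    innerAct ψ T (graft ψ c y z) = splitSum T fun a b =>
      graft ψ c (smashMul ψ (tree k R a) y) (innerAct ψ b z) := by
  induction c using Finsupp.induction_linear with
  | zero => simp
  | add c d hc hd => simp only [map_add, LinearMap.add_apply, hc, hd, splitSum_add]
  | single u r =>
    induction y using induction generalizing T with
    | zero => simp
    | add y y' hy hy' => simp only [map_add, LinearMap.add_apply, hy, hy', splitSum_add]
    | smul s y hy =>
      simp only [map_smul, LinearMap.smul_apply, innerAct_smul hψ, hy, smashMul_tree_smul hψ,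
        smul_splitSum]
      rw [← splitSum_assoc T fun a c d => ψ (KLT.tree a) s • graft ψ (Finsupp.single u r)
        (smashMul ψ (tree k R c) y) (innerAct ψ d z)]
      refine splitSum_congr T fun a b => ?_
      rw [← LinearMap.flip_apply, map_splitSum]
      simp only [LinearMap.flip_apply, map_smul]
    | tree C =>
      induction z using induction generalizing T with
      | zero => simp
      | add z z' hz hz' => simp only [map_add, hz, hz', splitSum_add]
      | smul s z hz =>
        simp only [map_smul, innerAct_smul hψ, hz, smul_splitSum, map_splitSum]
        exact splitSum_left_comm T fun a c d => ψ (KLT.tree a) s • graft ψ (Finsupp.single u r)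
          (smashMul ψ (tree k R c) (tree k R C)) (innerAct ψ d z)
      | tree F =>
        have h (x y : OTree ι) : graft ψ (Finsupp.single u r) (prodSum x C (tree k R))
            (innerSum y F (tree k R)) = splitSum x fun a a' => splitSum C fun c d =>
              prodSum a c fun P => prodSum a' d fun Q => innerSum y F fun Y =>
                ψ (KLT.tree P) r • tree k R (OTree.cons u Q Y) := by
          rw [← LinearMap.flip_apply, map_prodSum]
          simp only [LinearMap.flip_apply]
          simp only [map_innerSum, graft_single_tree, innerSum_splitSum_comm, prodSum_splitSum,
            cons_tree_tree]
        simp only [smashMul_tree_tree hψ, innerAct_tree hψ, h]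
        simp only [graft_single_tree, cons_tree_tree, map_splitSum, innerAct_smul hψ,
          innerAct_tree hψ, innerSum_cons, smul_splitSum]
        rw [splitSum_comm]
        rw [splitSum_assoc T fun a a' y => splitSum C fun c d =>
              prodSum a c fun P => prodSum a' d fun Q => innerSum y F fun Y =>
                ψ (KLT.tree P) r • tree k R (OTree.cons u Q Y)]
        refine splitSum_congr T fun a b => ?_
        rw [splitSum_comm]
        refine splitSum_congr b fun a' y => splitSum_congr C fun c d => ?_
        simp only [hψ.act_prodSum, prodSum_smul, smul_prodSum, smul_innerSum]
        rw [prodSum_comm]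
        exact prodSum_congr _ _ fun X => (prodSum_innerSum_comm ..).symm

end Graft

end Smash

/-! ### The normal form of a tree and its kernel. -/

namespace Smash

variable {k : Type*} [Field k] {R : Type*} [CommRing R] [Algebra k R] {S ι : Type*}

theorem smul_sub_smul (s : R) (x y : Smash k R S) : s • x - s • y = s • (x - y) :=
  (smul_sub s x y).symm

section Substitution

variable (ψ : KLT k S →ₗ[k] Module.End k R)

/-- The term `∑ (T_i)₁ · r # T(i, E, (T_i)₂)` of a substitution at the node `i` of `T`. -/
noncomputable def nodeSubst {T : OTree S} (i : T.Node) (E : S) (r : R) : Smash k R S :=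
  splitSum i.sub fun a b => ψ (KLT.tree a) r • tree k R (i.replace E b)

theorem nodeSubst_eq {T : OTree S} (i : T.Node) (E : S) (r : R) :
    (i.sub.splits.map fun p => ψ (KLT.tree p.1) r ⊗ₜ[k] KLT.tree (i.replace E p.2)).sum =
      nodeSubst ψ i E r := by
  simp only [nodeSubst, splitSum, ← tmul_tree]

theorem nodeSubst_down {E : S} {C F : OTree S} (i : C.Node) (G : S) (r : R) :
    nodeSubst ψ (.down i : (OTree.cons E C F).Node) G r =
      cons E (nodeSubst ψ i G r) (tree k R F) := by
  rw [← LinearMap.flip_apply, nodeSubst, nodeSubst, map_splitSum]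
  simp [Node.sub, Node.replace]

theorem nodeSubst_next {E : S} {C F : OTree S} (i : F.Node) (G : S) (r : R) :
    nodeSubst ψ (.next i : (OTree.cons E C F).Node) G r =
      cons E (tree k R C) (nodeSubst ψ i G r) := by
  rw [nodeSubst, nodeSubst, map_splitSum]
  simp [Node.sub, Node.replace]

/-- The action of an element of the smash product on `r`. -/
noncomputable def act (r : R) : Smash k R S →ₗ[R] R := ofTree fun T => ψ (KLT.tree T) r

@[simp] theorem act_tree (r : R) (T : OTree S) : act ψ r (tree k R T) = ψ (KLT.tree T) r := by
  simp [act]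

end Substitution

theorem graft_tree (ψ : KLT k ι →ₗ[k] Module.End k R) (c : ι →₀ R) (C : OTree ι)
    (z : Smash k R ι) : graft ψ c (tree k R C) z = c.sum fun u r =>
      splitSum C fun a b => ψ (KLT.tree a) r • cons u (tree k R b) z := by
  have h : graft ψ c = c.sum fun u r => graft ψ (Finsupp.single u r) := by
    simp only [graft, Finsupp.liftAddHom_apply_single]
    exact Finsupp.liftAddHom_apply _ _
  rw [h]
  simp only [Finsupp.sum, LinearMap.sum_apply, graft_single_tree]

section Relabel

variable (b : Module.Basis ι R (Derivation k R R))
  (ψ : KLT k (Derivation k R R) →ₗ[k] Module.End k R)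

/-- The restriction of an action to the trees labeled by basis elements. -/
noncomputable abbrev basisAct : KLT k ι →ₗ[k] Module.End k R := ψ ∘ₗ KLT.mapLabel b

/-- The normal form of a tree for the substitutions that expand the labels in a basis. -/
noncomputable def relabelTree : OTree (Derivation k R R) → Smash k R ι
  | one => tree k R one
  | OTree.cons E C F => graft (basisAct b ψ) (b.repr E) (relabelTree C) (relabelTree F)

/-- The `R`-linear extension of `relabelTree`. -/
noncomputable def relabel : Smash k R (Derivation k R R) →ₗ[R] Smash k R ι :=
  ofTree (relabelTree b ψ)

/-- The inclusion of the smash product spanned by the trees labeled by basis elements. -/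
noncomputable def ofBasis : Smash k R ι →ₗ[R] Smash k R (Derivation k R R) :=
  ofTree fun T => tree k R (T.map b)

@[simp] theorem ofBasis_tree (T : OTree ι) : ofBasis b (tree k R T) = tree k R (T.map b) := by
  simp [ofBasis]

@[simp] theorem relabel_one : relabel b ψ (tree k R one) = tree k R one := by
  simp [relabel, relabelTree]

theorem relabel_cons_tree (E : Derivation k R R) (C F : OTree (Derivation k R R)) :
    relabel b ψ (tree k R (OTree.cons E C F)) =
      graft (basisAct b ψ) (b.repr E) (relabel b ψ (tree k R C)) (relabel b ψ (tree k R F)) := by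
  simp [relabel, relabelTree]

theorem relabel_cons (E : Derivation k R R) (x y : Smash k R (Derivation k R R)) :
    relabel b ψ (cons E x y) = graft (basisAct b ψ) (b.repr E) (relabel b ψ x) (relabel b ψ y) := by
  induction x using induction with
  | zero => simp
  | add x x' hx hx' => simp only [map_add, LinearMap.add_apply, hx, hx']
  | smul s x hx => simp only [map_smul, LinearMap.smul_apply, hx]
  | tree C =>
    induction y using induction with
    | zero => simp
    | add x x' hx hx' => simp only [map_add, hx, hx']
    | smul s x hx => simp only [map_smul, hx]
    | tree F => rw [cons_tree_tree, relabel_cons_tree]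

/-- The span of the substitutions that expand a label in a basis. -/
noncomputable def basisIdeal : Submodule R (Smash k R (Derivation k R R)) :=
  Submodule.span R {x | ∃ (T : OTree (Derivation k R R)) (i : T.Node),
    x = tree k R T - (b.repr i.label).sum fun u r => nodeSubst ψ i (b u) r}

variable {b ψ}

theorem cons_mem_basisIdeal_left (E : Derivation k R R) {x : Smash k R (Derivation k R R)}
    (hx : x ∈ basisIdeal b ψ) (y : Smash k R (Derivation k R R)) :
    cons E x y ∈ basisIdeal b ψ := by
  induction y using induction with
  | zero => simp
  | add y y' hy hy' => rw [map_add]; exact add_mem hy hy'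
  | smul s y hy => rw [map_smul]; exact Submodule.smul_mem _ _ hy
  | tree F =>
    refine (Submodule.span_le (p := (basisIdeal b ψ).comap ((cons E).flip (tree k R F)))).2 ?_ hx
    rintro _ ⟨T, i, rfl⟩
    refine Submodule.subset_span ⟨OTree.cons E T F, .down i, ?_⟩
    rw [map_sub, map_finsuppSum]
    simp [nodeSubst_down, Node.label]

theorem cons_mem_basisIdeal_right (E : Derivation k R R) {y : Smash k R (Derivation k R R)}
    (hy : y ∈ basisIdeal b ψ) (x : Smash k R (Derivation k R R)) :
    cons E x y ∈ basisIdeal b ψ := by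
  induction x using induction with
  | zero => simp
  | add x x' hx hx' => rw [map_add]; exact add_mem hx hx'
  | smul s x hx => rw [map_smul]; exact Submodule.smul_mem _ _ hx
  | tree C =>
    refine (Submodule.span_le (p := (basisIdeal b ψ).comap (cons E (tree k R C)))).2 ?_ hy
    rintro _ ⟨T, i, rfl⟩
    refine Submodule.subset_span ⟨OTree.cons E C T, .next i, ?_⟩
    rw [map_sub, map_finsuppSum]
    simp [nodeSubst_next, Node.label]

/-- When all labels other than `E` are basis elements, a single substitution at the first child
already gives the grafted form. -/
theorem cons_sub_ofBasis_graft_mem (E : Derivation k R R) (x y : Smash k R ι) :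
    cons E (ofBasis b x) (ofBasis b y) - ofBasis b (graft (basisAct b ψ) (b.repr E) x y) ∈
      basisIdeal b ψ := by
  induction x using induction with
  | zero => simp
  | add x x' hx hx' =>
    simp only [map_add, LinearMap.add_apply, add_sub_add_comm]
    exact add_mem hx hx'
  | smul s x hx =>
    simp only [map_smul, LinearMap.smul_apply, smul_sub_smul]
    exact Submodule.smul_mem _ _ hx
  | tree C =>
    induction y using induction with
    | zero => simp
    | add x x' hx hx' =>
      simp only [map_add, add_sub_add_comm]
      exact add_mem hx hx'
    | smul s x hx =>
      simp only [map_smul, smul_sub_smul]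
      exact Submodule.smul_mem _ _ hx
    | tree F =>
      refine Submodule.subset_span ⟨OTree.cons E (C.map b) (F.map b), .here, ?_⟩
      rw [graft_tree, map_finsuppSum]
      simp [nodeSubst, Node.label, Node.sub, Node.replace, splitSum_map, map_splitSum,
        KLT.mapLabel_tree, OTree.map]

/-- Normalize the subtree of the first child, then the remaining children, then the label of the
first child; the three differences add up to the claim. -/
theorem tree_sub_ofBasis_relabel_mem (T : OTree (Derivation k R R)) :
    tree k R T - ofBasis b (relabel b ψ (tree k R T)) ∈ basisIdeal b ψ := by
  induction T with
  | one => simp [OTree.map]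
  | cons E C F ihC ihF =>
    have h₁ := cons_mem_basisIdeal_left E ihC (tree k R F)
    have h₂ := cons_mem_basisIdeal_right E ihF (ofBasis b (relabel b ψ (tree k R C)))
    have h₃ := cons_sub_ofBasis_graft_mem (b := b) (ψ := ψ) E (relabel b ψ (tree k R C))
      (relabel b ψ (tree k R F))
    convert add_mem (add_mem h₁ h₂) h₃ using 1
    simp only [map_sub, LinearMap.sub_apply, relabel_cons_tree, cons_tree_tree]
    abel

theorem sub_ofBasis_relabel_mem (x : Smash k R (Derivation k R R)) :
    x - ofBasis b (relabel b ψ x) ∈ basisIdeal b ψ := by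
  induction x using induction with
  | zero => simp
  | add x x' hx hx' =>
    simp only [map_add, add_sub_add_comm]
    exact add_mem hx hx'
  | smul s x hx =>
    simp only [map_smul, smul_sub_smul]
    exact Submodule.smul_mem _ _ hx
  | tree T => exact tree_sub_ofBasis_relabel_mem T

/-- Turns a basis expansion into a sum over `Fin n`, the shape used by `IsLeibnitz` and
`leibnitzIdeal`. -/
theorem finsuppSum_eq_sum_fin {α M N : Type*} [Zero M] [AddCommMonoid N] (c : α →₀ M)
    (f : α → M → N) : c.sum f = ∑ j : Fin c.support.card,
      f (c.support.equivFin.symm j) (c (c.support.equivFin.symm j)) := by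
  rw [Finsupp.sum, ← Finset.sum_coe_sort]
  exact (Equiv.sum_comp c.support.equivFin.symm fun x : c.support => f x (c x)).symm

theorem basisIdeal_le : basisIdeal b ψ ≤ leibnitzIdeal ψ := by
  refine Submodule.span_mono ?_
  rintro _ ⟨T, i, rfl⟩
  have h := b.linearCombination_repr i.label
  rw [Finsupp.linearCombination_apply, finsuppSum_eq_sum_fin] at h
  refine ⟨T, i, _, _, _, h.symm, ?_⟩
  simp only [nodeSubst_eq]
  rw [finsuppSum_eq_sum_fin]

/-- On a generator of the ideal, vanishing of the action is precisely the Leibnitz identity. -/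
theorem act_eq_zero (hL : IsLeibnitz ψ) (s : R) {x : Smash k R (Derivation k R R)}
    (hx : x ∈ leibnitzIdeal ψ) : act ψ s x = 0 := by
  refine (Submodule.span_le (p := LinearMap.ker (act ψ s))).2 ?_ hx
  rintro _ ⟨T, i, n, r, E, h, rfl⟩
  have h' := hL T i n r E h s
  simp only [nodeSubst_eq, SetLike.mem_coe, LinearMap.mem_ker, map_sub, act_tree, h', map_sum]
  simp only [nodeSubst, map_splitSum, map_smul, act_tree, smul_eq_mul]
  exact sub_self _

theorem act_ofBasis (s : R) (y : Smash k R ι) :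
    act ψ s (ofBasis b y) = act (basisAct b ψ) s y :=
  LinearMap.congr_fun (linearMap_ext (f := act ψ s ∘ₗ ofBasis b) fun T => by
    simp [KLT.mapLabel_tree]) y

theorem act_relabel (hL : IsLeibnitz ψ) (s : R) (x : Smash k R (Derivation k R R)) :
    act (basisAct b ψ) s (relabel b ψ x) = act ψ s x := by
  have h := act_eq_zero hL s (basisIdeal_le (sub_ofBasis_relabel_mem (b := b) (ψ := ψ) x))
  rw [map_sub, sub_eq_zero, act_ofBasis] at h
  exact h.symm

/-- `smashComul_graft` and `splitSum_cons` are the same recursion. -/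
theorem smashComul_relabel_tree (T : OTree (Derivation k R R)) :
    smashComul k R ι (relabel b ψ (tree k R T)) =
      splitSum T fun x y => relabel b ψ (tree k R x) ⊗ₜ[R] relabel b ψ (tree k R y) := by
  induction T with
  | one => simp [smashComul_tree]
  | cons E C F ihC ihF =>
    rw [relabel_cons_tree, smashComul_graft, ihF, map_splitSum, map_splitSum, splitSum_cons]
    simp [relabel_cons_tree]

theorem lift_smashComul_relabel_tree {N : Type*} [AddCommMonoid N] [Module R N]
    (B : Smash k R ι →ₗ[R] Smash k R ι →ₗ[R] N) (T : OTree (Derivation k R R)) :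
    TensorProduct.lift B (smashComul k R ι (relabel b ψ (tree k R T))) =
      splitSum T fun x y => B (relabel b ψ (tree k R x)) (relabel b ψ (tree k R y)) := by
  rw [smashComul_relabel_tree, map_splitSum]
  rfl

theorem smashComul_relabel (x : Smash k R (Derivation k R R)) :
    smashComul k R ι (relabel b ψ x) =
      TensorProduct.map (relabel b ψ) (relabel b ψ) (smashComul k R _ x) :=
  LinearMap.congr_fun (linearMap_ext (f := smashComul k R ι ∘ₗ relabel b ψ)
    (g := TensorProduct.map (relabel b ψ) (relabel b ψ) ∘ₗ smashComul k R _) fun T => by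
      simp [smashComul_relabel_tree, smashComul_tree, map_splitSum]) x

theorem smashCounit_graft {ψ : KLT k ι →ₗ[k] Module.End k R} (c : ι →₀ R) (x y : Smash k R ι) :
    smashCounit k R ι (graft ψ c x y) = 0 := by
  have h (u : ι) (x y : Smash k R ι) : smashCounit k R ι (cons u x y) = 0 := by
    have : (cons u).compr₂ (smashCounit k R ι) = 0 :=
      linearMap_ext fun C => linearMap_ext fun F => by simp [smashCounit_tree]
    exact LinearMap.congr_fun (LinearMap.congr_fun this x) y
  have : (graft ψ c).compr₂ (smashCounit k R ι) = 0 :=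
    linearMap_ext fun C => LinearMap.ext fun y => by
      simp [graft_tree, map_finsuppSum, map_splitSum, h]
  exact LinearMap.congr_fun (LinearMap.congr_fun this x) y

theorem smashCounit_relabel (x : Smash k R (Derivation k R R)) :
    smashCounit k R ι (relabel b ψ x) = smashCounit k R _ x :=
  LinearMap.congr_fun (linearMap_ext (f := smashCounit k R ι ∘ₗ relabel b ψ) fun T => by
    cases T with
    | one => simp [smashCounit_tree]
    | cons E C F => simp [smashCounit_tree, relabel_cons_tree, smashCounit_graft]) x

/-- Invariance puts `basisIdeal` in the kernel of `α`, and `α` undoes `ofBasis`; applying `α` to `x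
- ofBasis b (relabel b ψ x)` determines it. -/
theorem eq_relabel {α : Smash k R (Derivation k R R) →ₗ[R] Smash k R ι}
    (hα : IsRelabeling ψ b α) : α = relabel b ψ := by
  have h₁ : basisIdeal b ψ ≤ LinearMap.ker α := by
    refine Submodule.span_le.2 ?_
    rintro _ ⟨T, i, rfl⟩
    have h := hα.subst T i
    simp only [nodeSubst_eq] at h
    rw [SetLike.mem_coe, LinearMap.mem_ker, map_sub, h, sub_self]
  have h₂ (y : Smash k R ι) : α (ofBasis b y) = y :=
    LinearMap.congr_fun (linearMap_ext (f := α ∘ₗ ofBasis b) (g := LinearMap.id) fun T => by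
      simpa using hα.basis T) y
  refine LinearMap.ext fun x => ?_
  have h := h₁ (sub_ofBasis_relabel_mem x)
  rwa [LinearMap.mem_ker, map_sub, h₂, sub_eq_zero] at h

section

variable (hψ : IsModuleAlgebra ψ)
include hψ

theorem relabel_ofBasis (y : Smash k R ι) : relabel b ψ (ofBasis b y) = y := by
  refine LinearMap.congr_fun (linearMap_ext (f := relabel b ψ ∘ₗ ofBasis b)
    (g := LinearMap.id) fun T => ?_) y
  simp only [LinearMap.comp_apply, ofBasis_tree, LinearMap.id_apply]
  induction T with
  | one => simp [OTree.map]
  | cons u C F ihC ihF =>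
    rw [OTree.map, relabel_cons_tree, b.repr_self, graft_single_one (hψ.comp_mapLabel b), ihC, ihF,
      cons_tree_tree]

/-- Moving `r` past the normal form of `C` involves its coproduct and its action on `r`. The first
may be computed on `C` because normalizing is a coalgebra map, the second by `act_relabel`. -/
theorem graft_smul_relabel_tree (hL : IsLeibnitz ψ) (r : R) (c : ι →₀ R)
    (C : OTree (Derivation k R R)) (z : Smash k R ι) :
    graft (basisAct b ψ) (r • c) (relabel b ψ (tree k R C)) z =
      splitSum C fun x y => ψ (KLT.tree x) r •
        graft (basisAct b ψ) c (relabel b ψ (tree k R y)) z := by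
  -- In a form linear in the grafted element, the rule for trees extends to elements such as
  -- `relabel b ψ (tree k R C)`, which are not single trees.
  have h : (graft (basisAct b ψ) (r • c)).flip z = TensorProduct.lift
      ((LinearMap.lsmul R (Smash k R ι)).compl₁₂ (act (basisAct b ψ) r)
        ((graft (basisAct b ψ) c).flip z)) ∘ₗ smashComul k R ι :=
    linearMap_ext fun T => by
      simp [lift_smashComul_tree, graft_smul_tree (hψ.comp_mapLabel b)]
  rw [← LinearMap.flip_apply, h, LinearMap.comp_apply, lift_smashComul_relabel_tree]
  simp [act_relabel hL]

/-- Only the case where `i` is the first child has content: there an arbitrary expression of the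
label is expanded in the basis and the coefficients are moved out. Deeper nodes follow from
`relabel_cons`. -/
theorem relabel_sum_nodeSubst (hL : IsLeibnitz ψ) {T : OTree (Derivation k R R)} (i : T.Node)
    {n : ℕ} (r : Fin n → R) (E : Fin n → Derivation k R R) (h : i.label = ∑ u, r u • E u) :
    relabel b ψ (∑ u, nodeSubst ψ i (E u) (r u)) = relabel b ψ (tree k R T) := by
  induction i with
  | @here E' C F =>
    rw [relabel_cons_tree, show E' = _ from h]
    simp only [map_sum, map_smul, LinearMap.sum_apply, graft_smul_relabel_tree hψ hL]
    refine Finset.sum_congr rfl fun u _ => ?_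
    simp [nodeSubst, map_splitSum, Node.sub, Node.replace, relabel_cons_tree]
  | @down E' C F i ih =>
    rw [← cons_tree_tree, relabel_cons, ← ih h]
    simp [nodeSubst_down, relabel_cons]
  | @next E' C F i ih =>
    rw [← cons_tree_tree, relabel_cons, ← ih h]
    simp [nodeSubst_next, relabel_cons]

theorem leibnitzIdeal_eq_ker (hL : IsLeibnitz ψ) :
    LinearMap.ker (relabel b ψ) = leibnitzIdeal ψ := by
  refine le_antisymm (fun x hx => ?_) (Submodule.span_le.2 ?_)
  · have h := basisIdeal_le (sub_ofBasis_relabel_mem (b := b) (ψ := ψ) x)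
    rwa [LinearMap.mem_ker.1 hx, map_zero, sub_zero] at h
  · rintro _ ⟨T, i, n, r, E, h, rfl⟩
    simp only [nodeSubst_eq, SetLike.mem_coe, LinearMap.mem_ker]
    rw [map_sub, relabel_sum_nodeSubst hψ hL i r E h, sub_self]

theorem isRelabeling_relabel (hL : IsLeibnitz ψ) : IsRelabeling ψ b (relabel b ψ) where
  subst T i := by
    have h := b.linearCombination_repr i.label
    rw [Finsupp.linearCombination_apply, finsuppSum_eq_sum_fin] at h
    simp only [nodeSubst_eq]
    rw [finsuppSum_eq_sum_fin, relabel_sum_nodeSubst hψ hL i _ _ h.symm]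
  basis T := by
    rw [← tree, ← tree, ← ofBasis_tree, relabel_ofBasis hψ]

end

end Relabel

end Smash

/-! ### Multiplicativity of the normal form. -/

namespace Smash

variable {k : Type*} [Field k] {R : Type*} [CommRing R] [Algebra k R] {S ι : Type*}

section Mul

variable (ψ : KLT k S →ₗ[k] Module.End k R)

/-- `x ↦ x * y` as an `R`-linear map. -/
noncomputable def mulRight (y : Smash k R S) : Smash k R S →ₗ[R] Smash k R S where
  toFun x := smashMul ψ x y
  map_add' x x' := by simp
  map_smul' r x := smashMul_smul ψ r x y

@[simp] theorem mulRight_apply (x y : Smash k R S) : mulRight ψ y x = smashMul ψ x y := rfl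

/-- The action `innerAct` of trees, extended to an `R`-linear function of the tree. -/
noncomputable def innerRight (y : Smash k R S) : Smash k R S →ₗ[R] Smash k R S :=
  ofTree fun T => innerAct ψ T y

@[simp] theorem innerRight_tree (T : OTree S) (y : Smash k R S) :
    innerRight ψ y (tree k R T) = innerAct ψ T y := by
  simp [innerRight]

variable {ψ} (hψ : IsModuleAlgebra ψ)
include hψ

theorem smashMul_assoc (x y z : Smash k R S) :
    smashMul ψ (smashMul ψ x y) z = smashMul ψ x (smashMul ψ y z) := by
  induction x using induction with
  | zero => simp
  | add x x' hx hx' => simp only [map_add, LinearMap.add_apply, hx, hx']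
  | smul s x hx => simp only [smashMul_smul, hx]
  | tree T =>
    induction y using induction generalizing T with
    | zero => simp
    | add y y' hy hy' => simp only [map_add, LinearMap.add_apply, hy, hy']
    | smul s y hy =>
      simp only [smashMul_smul, smashMul_tree_smul hψ, ← hy]
      rw [← mulRight_apply, map_splitSum]
      simp only [map_smul, mulRight_apply]
    | tree G => exact smashMul_tree_assoc hψ T G z

theorem coeff_smashMul (s : R) (y : Smash k R S) :
    smashMul ψ (s ⊗ₜ KLT.tree one) y = s • y := by
  rw [tmul_tree, smashMul_smul, one_smashMul hψ]

/-- Right multiplication, and likewise the maps below, is written as a composite with the coproduct.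
Such a formula can be evaluated at a normal form through `lift_smashComul_relabel_tree`. -/
theorem mulRight_eq (y : Smash k R S) : mulRight ψ y =
    TensorProduct.lift (join.compl₁₂ LinearMap.id (innerRight ψ y)) ∘ₗ smashComul k R S :=
  linearMap_ext fun T => by
    simp [lift_smashComul_tree, smashMul_tree_eq_splitSum hψ]

theorem mulRight_smul (s : R) (y : Smash k R S) : mulRight ψ (s • y) =
    TensorProduct.lift ((LinearMap.lsmul R (Smash k R S)).compl₁₂ (act ψ s) (mulRight ψ y)) ∘ₗ
      smashComul k R S :=
  linearMap_ext fun T => by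
    simp [lift_smashComul_tree, smashMul_tree_smul hψ]

theorem innerRight_graft (c : S →₀ R) (y z : Smash k R S) : innerRight ψ (graft ψ c y z) =
    TensorProduct.lift ((graft ψ c).compl₁₂ (mulRight ψ y) (innerRight ψ z)) ∘ₗ
      smashComul k R S :=
  linearMap_ext fun T => by
    simp [lift_smashComul_tree, innerAct_graft hψ]

theorem innerRight_one : innerRight ψ (tree k R one) =
    (smashCounit k R S).smulRight (tree k R one) :=
  linearMap_ext fun T => by
    cases T <;> simp [innerAct_tree hψ, innerSum_one, smashCounit_tree]

end Mul

section RelabelMul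

variable {b : Module.Basis ι R (Derivation k R R)}
  {ψ : KLT k (Derivation k R R) →ₗ[k] Module.End k R}

theorem relabel_join_tree (T G : OTree (Derivation k R R)) :
    relabel b ψ (tree k R (OTree.join T G)) =
      join (relabel b ψ (tree k R T)) (relabel b ψ (tree k R G)) := by
  induction T with
  | one =>
    have h : join (tree k R one) = (LinearMap.id : Smash k R ι →ₗ[R] _) :=
      linearMap_ext fun F => by simp
    simp [h]
  | cons E C F _ ih => rw [OTree.join, relabel_cons_tree, relabel_cons_tree, join_graft, ih]

variable (hψ : IsModuleAlgebra ψ)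
include hψ

theorem relabel_prodSum_of_innerSum (G : OTree (Derivation k R R))
    (hG : ∀ T, innerSum T G (fun X => relabel b ψ (tree k R X)) =
      innerRight (basisAct b ψ) (relabel b ψ (tree k R G)) (relabel b ψ (tree k R T)))
    (T : OTree (Derivation k R R)) : prodSum T G (fun X => relabel b ψ (tree k R X)) =
      smashMul (basisAct b ψ) (relabel b ψ (tree k R T)) (relabel b ψ (tree k R G)) := by
  rw [← mulRight_apply, mulRight_eq (hψ.comp_mapLabel b), LinearMap.comp_apply,
    lift_smashComul_relabel_tree, prodSum_eq]
  simp only [relabel_join_tree, ← map_innerSum, hG]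
  rfl

/-- Induction on `G`: `innerSum_cons` on one side matches `innerRight_graft` on the other, with the
product statement for `C` supplied by the induction hypothesis. -/
theorem relabel_innerSum (T G : OTree (Derivation k R R)) :
    innerSum T G (fun X => relabel b ψ (tree k R X)) =
      innerRight (basisAct b ψ) (relabel b ψ (tree k R G)) (relabel b ψ (tree k R T)) := by
  induction G generalizing T with
  | one =>
    rw [innerSum_one, relabel_one, innerRight_one (hψ.comp_mapLabel b), LinearMap.smulRight_apply,
      smashCounit_relabel, smashCounit_tree]
    cases T <;> simp
  | cons E C F ihC ihF =>
    rw [relabel_cons_tree, innerRight_graft (hψ.comp_mapLabel b), LinearMap.comp_apply,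
      lift_smashComul_relabel_tree, innerSum_cons]
    refine splitSum_congr T fun x y => ?_
    simp only [relabel_cons_tree, ← map_innerSum, ihF, LinearMap.compl₁₂_apply, mulRight_apply,
      ← relabel_prodSum_of_innerSum hψ C ihC]
    rw [← LinearMap.flip_apply, map_prodSum]
    rfl

/-- The Leibnitz condition is needed only for scalars in `y`, on which `T` and its normal form have
to act alike. -/
theorem relabel_smashMul (hL : IsLeibnitz ψ) (x y : Smash k R (Derivation k R R)) :
    relabel b ψ (smashMul ψ x y) = smashMul (basisAct b ψ) (relabel b ψ x) (relabel b ψ y) := by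
  induction x using induction with
  | zero => simp
  | add x x' hx hx' => simp only [map_add, LinearMap.add_apply, hx, hx']
  | smul s x hx => simp only [smashMul_smul, map_smul, hx]
  | tree T =>
    induction y using induction generalizing T with
    | zero => simp
    | add y y' hy hy' => simp only [map_add, hy, hy']
    | smul s y hy =>
      rw [(relabel b ψ).map_smul, ← mulRight_apply (basisAct b ψ), mulRight_smul (hψ.comp_mapLabel b),
        LinearMap.comp_apply, lift_smashComul_relabel_tree, smashMul_tree_smul hψ, map_splitSum]
      refine splitSum_congr T fun x z => ?_
      rw [(relabel b ψ).map_smul, hy, LinearMap.compl₁₂_apply, act_relabel hL, act_tree,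
        LinearMap.lsmul_apply, mulRight_apply]
    | tree G =>
      rw [smashMul_tree_tree hψ, map_prodSum]
      exact relabel_prodSum_of_innerSum hψ G (fun T => relabel_innerSum hψ T G) T

end RelabelMul

/-! ### The antiproduct as the inverse of the Galois map. -/

section Antiproduct

variable {σ : KLT k S →ₗ[k] KLT k S}

theorem antiproduct_tree (T : OTree S) : antiproduct σ (tree k R T) =
    splitSum T fun a b => tree k R a ⊗ₜ[k] ((1 : R) ⊗ₜ[k] σ (KLT.tree b)) := by
  simp only [antiproduct, LinearMap.comp_apply, LinearMap.lTensor_tmul, KLT.comul_tree]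
  rw [← TensorProduct.mk_apply]
  simp only [map_splitSum]
  rfl

theorem antiproduct_smul (r : R) (x : Smash k R S) :
    antiproduct σ (r • x) = r • antiproduct σ x := by
  induction x using TensorProduct.induction_on with
  | zero => simp
  | add x y hx hy => simp only [smul_add, map_add, hx, hy]
  | tmul s h =>
    simp only [antiproduct, LinearMap.comp_apply, LinearMap.lTensor_tmul,
      TensorProduct.smul_tmul']
    induction KLT.comul h using TensorProduct.induction_on with
    | zero => simp
    | add x y hx hy => simp only [TensorProduct.tmul_add, map_add, hx, hy, smul_add]
    | tmul x y => simp [TensorProduct.smul_tmul']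

theorem map_restrictScalars_smul {M N : Type*} [AddCommGroup M] [AddCommGroup N]
    [Module R M] [Module k M] [IsScalarTower k R M] [Module R N] [Module k N] [IsScalarTower k R N]
    (f : M →ₗ[R] N) (r : R) (z : M ⊗[k] M) :
    TensorProduct.map (f.restrictScalars k) (f.restrictScalars k) (r • z) =
      r • TensorProduct.map (f.restrictScalars k) (f.restrictScalars k) z := by
  induction z using TensorProduct.induction_on with
  | zero => simp
  | add x y hx hy => simp only [smul_add, map_add, hx, hy]
  | tmul x y => simp [TensorProduct.smul_tmul']

variable (ψ : KLT k S →ₗ[k] Module.End k R)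

theorem smul_mem_middleRel (r : R) {z : Smash k R S ⊗[k] Smash k R S} (hz : z ∈ middleRel ψ) :
    r • z ∈ middleRel ψ := by
  induction hz using Submodule.span_induction with
  | mem z hz =>
    obtain ⟨x, y, s, rfl⟩ := hz
    refine Submodule.subset_span ⟨r • x, y, s, ?_⟩
    rw [smashMul_smul, smul_sub, TensorProduct.smul_tmul', TensorProduct.smul_tmul']
  | zero => simp
  | add x y _ _ hx hy => rw [smul_add]; exact add_mem hx hy
  | smul c x _ hx => rw [smul_comm]; exact Submodule.smul_mem _ c hx

/-- Replaces membership in `middleRel` by vanishing of an `R`-linear map, so that the arguments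
below take place in an `R`-module. -/
theorem exists_ker_eq {M : Type v} [AddCommMonoid M] [Module R M] (P : Submodule R M) :
    ∃ (N : Type v) (_ : AddCommGroup N) (_ : Module R N) (π : M →ₗ[R] N),
      ∀ z, π z = 0 ↔ z ∈ P := by
  let := Module.addCommMonoidToAddCommGroup R (M := M)
  exact ⟨M ⧸ P, inferInstance, inferInstance, P.mkQ, fun z => by simp⟩

variable {N : Type*} [AddCommGroup N] [Module R N] (π : Smash k R S ⊗[k] Smash k R S →ₗ[R] N)

/-- The term `∑ T₁ ⊗ σ(T₂) y` of the tensor square over the middle action. -/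
noncomputable def transl (σ : KLT k S →ₗ[k] KLT k S) (T : OTree S) (y : Smash k R S) : N :=
  splitSum T fun a b => π (tree k R a ⊗ₜ[k] smashMul ψ (1 ⊗ₜ σ (KLT.tree b)) y)

variable {ψ π}

theorem transl_add (T : OTree S) (y z : Smash k R S) :
    transl ψ π σ T (y + z) = transl ψ π σ T y + transl ψ π σ T z := by
  simp only [transl, map_add, TensorProduct.tmul_add, splitSum_add]

variable (hψ : IsModuleAlgebra ψ)
include hψ

theorem splitSum_antipode_mul (hσ : KLT.IsAntipode σ) (b : OTree S) (y : Smash k R S) :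
    splitSum b (fun c d => smashMul ψ (1 ⊗ₜ σ (KLT.tree c)) (smashMul ψ (tree k R d) y)) =
      eps b y := by
  simp only [tree, ← smashMul_tmul_assoc hψ]
  refine (map_splitSum ((smashMul ψ).flip y ∘ₗ TensorProduct.mk k R (KLT k S) 1) b
    fun c d => KLT.mul (σ (KLT.tree c)) (KLT.tree d)).symm.trans ?_
  rw [hσ.splitSum_mul, map_eps]
  simp [one_smashMul hψ]

/-- In `∑ T₁ ⊗ σ(T₂) T₃ y` the antipode cancels the last two factors. Hence `transl` inverts `x ⊗ w
↦ ∑ x₁ ⊗ x₂ w`. -/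
theorem splitSum_transl (hσ : KLT.IsAntipode σ) (T : OTree S) (y : Smash k R S) :
    splitSum T (fun a b => transl ψ π σ a (smashMul ψ (tree k R b) y)) =
      π (tree k R T ⊗ₜ[k] y) := by
  simp only [transl]
  rw [splitSum_assoc T fun a c b => π (tree k R a ⊗ₜ[k]
    smashMul ψ (1 ⊗ₜ σ (KLT.tree c)) (smashMul ψ (tree k R b) y)),
    ← splitSum_eps_right T fun a => π (tree k R a ⊗ₜ[k] y)]
  refine splitSum_congr T fun a b => ?_
  have h := map_splitSum (π.toAddMonoidHom.comp (TensorProduct.mk k _ _ (tree k R a)).toAddMonoidHom) b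
    fun c d => smashMul ψ (1 ⊗ₜ σ (KLT.tree c)) (smashMul ψ (tree k R d) y)
  rw [splitSum_antipode_mul hψ hσ, map_eps] at h
  exact h.symm

theorem transl_smul (hσ : KLT.IsAntipode σ) (hπ : ∀ z ∈ middleRel ψ, π z = 0)
    (T : OTree S) (r : R) (y : Smash k R S) :
    transl ψ π σ T (r • y) = r • transl ψ π σ T y := by
  -- The middle relation moves `s` from the right factor to the left one.
  have hmid (x y : Smash k R S) (s : R) :
      π (x ⊗ₜ[k] (s • y)) = π (smashMul ψ x (s ⊗ₜ KLT.tree one) ⊗ₜ[k] y) := by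
    have h := hπ _ (Submodule.subset_span ⟨x, y, s, rfl⟩)
    rw [← coeff_smashMul hψ, ← zero_add (π _), ← h, ← map_add, sub_add_cancel]
  induction T using rootDegree_induction generalizing r y with
  | h T ih =>
    have h₁ : splitSum T (fun a b => splitSum b fun c d =>
        transl ψ π σ a (ψ (KLT.tree c) r • smashMul ψ (tree k R d) y)) =
        splitSum T fun a b => ψ (KLT.tree a) r • π (tree k R b ⊗ₜ[k] y) := by
      have hadd (a : OTree S) := map_splitSum (S := S) (M := Smash k R S)
        (AddMonoidHom.mk' (transl ψ π σ a) (transl_add a))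
      simp only [AddMonoidHom.mk'_apply] at hadd
      simp only [← hadd, ← smashMul_tree_smul hψ]
      rw [splitSum_transl hψ hσ, hmid, tmul_tree, smashMul_tree_smul hψ]
      simp only [smashMul_one hψ]
      refine (map_splitSum (π.toAddMonoidHom.comp
        ((TensorProduct.mk k (Smash k R S) (Smash k R S)).flip y).toAddMonoidHom) T _).trans ?_
      exact splitSum_congr T fun a b => π.map_smul _ (tree k R b ⊗ₜ[k] y)
    -- With the scalar outside, cocommutativity brings its tree to the front and `splitSum_transl`
    -- sums the rest.
    have h₂ : splitSum T (fun a b => splitSum b fun c d =>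
        ψ (KLT.tree c) r • transl ψ π σ a (smashMul ψ (tree k R d) y)) =
        splitSum T fun a b => ψ (KLT.tree a) r • π (tree k R b ⊗ₜ[k] y) := by
      rw [splitSum_left_comm T fun a c d =>
        ψ (KLT.tree c) r • transl ψ π σ a (smashMul ψ (tree k R d) y)]
      simp only [← smul_splitSum, splitSum_transl hψ hσ]
    have h₃ := (sub_eq_zero.2 (h₁.trans h₂.symm))
    simp only [← splitSum_sub] at h₃
    rw [splitSum_eq_of_rootDegree_lt] at h₃
    · simpa [one_smashMul hψ, hψ.one_act, sub_eq_zero] using h₃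
    · intro a b hab
      simp only [ih a hab, sub_self, splitSum_zero]

theorem transl_one (T : OTree S) :
    transl ψ π σ T (tree k R one) = π (antiproduct σ (tree k R T)) := by
  rw [antiproduct_tree, map_splitSum]
  simp only [transl, smashMul_one hψ]

/-- The `R`-bilinear extension of `transl`. -/
noncomputable def translLin (hσ : KLT.IsAntipode σ) (hπ : ∀ z ∈ middleRel ψ, π z = 0) :
    Smash k R S →ₗ[R] Smash k R S →ₗ[R] N :=
  ofTree fun T =>
    { toFun := transl ψ π σ T
      map_add' := transl_add T
      map_smul' := transl_smul hψ hσ hπ T }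

theorem translLin_tree (hσ : KLT.IsAntipode σ) (hπ : ∀ z ∈ middleRel ψ, π z = 0) (T : OTree S)
    (y : Smash k R S) : translLin hψ hσ hπ (tree k R T) y = transl ψ π σ T y := by
  rw [translLin, ofTree_tree]
  rfl

theorem translLin_one (hσ : KLT.IsAntipode σ) (hπ : ∀ z ∈ middleRel ψ, π z = 0)
    (x : Smash k R S) : translLin hψ hσ hπ x (tree k R one) = π (antiproduct σ x) := by
  induction x using induction with
  | zero => simp
  | add x y hx hy => simp only [map_add, LinearMap.add_apply, hx, hy]
  | smul s x hx => simp only [map_smul, LinearMap.smul_apply, hx, antiproduct_smul]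
  | tree T => rw [translLin_tree, transl_one hψ]

theorem lift_translLin (hσ : KLT.IsAntipode σ) (hπ : ∀ z ∈ middleRel ψ, π z = 0)
    (x w : Smash k R S) :
    TensorProduct.lift ((translLin hψ hσ hπ).compl₁₂ LinearMap.id (mulRight ψ w))
      (smashComul k R S x) = π (x ⊗ₜ[k] w) := by
  induction x using induction with
  | zero => simp
  | add x y hx hy => simp only [map_add, hx, hy, TensorProduct.add_tmul]
  | smul s x hx => rw [map_smul, map_smul, hx, ← map_smul, TensorProduct.smul_tmul']
  | tree T =>
    rw [lift_smashComul_tree, ← splitSum_transl hψ hσ]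
    simp [translLin_tree]

end Antiproduct

section RelabelAntiproduct

variable {b : Module.Basis ι R (Derivation k R R)}
  {ψ : KLT k (Derivation k R R) →ₗ[k] Module.End k R}
  {σ : KLT k (Derivation k R R) →ₗ[k] KLT k (Derivation k R R)} {σ' : KLT k ι →ₗ[k] KLT k ι}
  {N : Type*} [AddCommGroup N] [Module R N] {π : Smash k R ι ⊗[k] Smash k R ι →ₗ[R] N}
  (hψ : IsModuleAlgebra ψ)
include hψ

/-- Both sides solve the same triangular equation: summed against left multiplication by the normal
form of `T₂`, each gives `π (relabel b ψ (tree k R T) ⊗ₜ w)`. Uniqueness of the solution is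
induction on the root degree. -/
theorem translLin_relabel_tree (hL : IsLeibnitz ψ) (hσ : KLT.IsAntipode σ) (hσ' : KLT.IsAntipode σ')
    (hπ : ∀ z ∈ middleRel (basisAct b ψ), π z = 0) (T : OTree (Derivation k R R))
    (w : Smash k R ι) :
    translLin (hψ.comp_mapLabel b) hσ' hπ (relabel b ψ (tree k R T)) w =
      splitSum T fun x y => π (relabel b ψ (tree k R x) ⊗ₜ[k]
        smashMul (basisAct b ψ) (relabel b ψ (1 ⊗ₜ σ (KLT.tree y))) w) := by
  induction T using rootDegree_induction generalizing w with
  | h T ih =>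
    have h₁ := lift_translLin (hψ.comp_mapLabel b) hσ' hπ (relabel b ψ (tree k R T)) w
    rw [lift_smashComul_relabel_tree] at h₁
    simp only [LinearMap.compl₁₂_apply, LinearMap.id_apply, mulRight_apply] at h₁
    -- The antipode `σ` cancels before normalizing, which is legitimate because `relabel` is
    -- multiplicative.
    have h₂ : splitSum T (fun x y => splitSum x fun c d => π (relabel b ψ (tree k R c) ⊗ₜ[k]
        smashMul (basisAct b ψ) (relabel b ψ (1 ⊗ₜ σ (KLT.tree d)))
          (smashMul (basisAct b ψ) (relabel b ψ (tree k R y)) w))) =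
        π (relabel b ψ (tree k R T) ⊗ₜ[k] w) := by
      simp only [← smashMul_assoc (hψ.comp_mapLabel b), ← relabel_smashMul hψ hL]
      rw [splitSum_assoc T fun c d y => π (relabel b ψ (tree k R c) ⊗ₜ[k]
        smashMul (basisAct b ψ) (relabel b ψ (smashMul ψ (1 ⊗ₜ σ (KLT.tree d)) (tree k R y))) w),
        ← splitSum_eps_right T fun a => π (relabel b ψ (tree k R a) ⊗ₜ[k] w)]
      refine splitSum_congr T fun x y => ?_
      have h := map_splitSum (π.toAddMonoidHom.comp
        (TensorProduct.mk k _ _ (relabel b ψ (tree k R x)) ∘ₗ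
        (smashMul (basisAct b ψ)).flip w ∘ₗ (relabel b ψ).restrictScalars k).toAddMonoidHom) y
        fun c d => smashMul ψ (1 ⊗ₜ σ (KLT.tree c)) (smashMul ψ (tree k R d) (tree k R one))
      rw [splitSum_antipode_mul hψ hσ, map_eps] at h
      simp only [smashMul_one hψ] at h
      refine h.symm.trans ?_
      simp [one_smashMul (hψ.comp_mapLabel b)]
    have h₃ := sub_eq_zero.2 (h₁.trans h₂.symm)
    rw [← splitSum_sub, splitSum_eq_of_rootDegree_lt] at h₃
    · simpa [one_smashMul (hψ.comp_mapLabel b), sub_eq_zero] using h₃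
    · intro x y hxy
      rw [ih x hxy, sub_self]

theorem map_antiproduct_relabel (hL : IsLeibnitz ψ) (hσ : KLT.IsAntipode σ) (hσ' : KLT.IsAntipode σ')
    (hπ : ∀ z ∈ middleRel (basisAct b ψ), π z = 0) (x : Smash k R (Derivation k R R)) :
    π (antiproduct σ' (relabel b ψ x)) = π (TensorProduct.map ((relabel b ψ).restrictScalars k)
      ((relabel b ψ).restrictScalars k) (antiproduct σ x)) := by
  rw [← translLin_one (hψ.comp_mapLabel b) hσ' hπ]
  induction x using induction with
  | zero => simp
  | add x y hx hy => simp only [map_add, LinearMap.add_apply, hx, hy]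
  | smul s x hx =>
    rw [map_smul, map_smul, LinearMap.smul_apply, hx, antiproduct_smul, ← map_smul]
    rw [map_restrictScalars_smul]
  | tree T =>
    rw [translLin_relabel_tree hψ hL hσ hσ', antiproduct_tree, map_splitSum, map_splitSum]
    simp [smashMul_one (hψ.comp_mapLabel b)]

theorem antiproduct_relabel_sub_mem (hL : IsLeibnitz ψ) (hσ : KLT.IsAntipode σ)
    (hσ' : KLT.IsAntipode σ') (x : Smash k R (Derivation k R R)) :
    antiproduct σ' (relabel b ψ x) - TensorProduct.map ((relabel b ψ).restrictScalars k)
      ((relabel b ψ).restrictScalars k) (antiproduct σ x) ∈ middleRel (basisAct b ψ) := by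
  obtain ⟨N, _, _, π, hπ⟩ := exists_ker_eq (R := R)
    { middleRel (basisAct b ψ) with
      smul_mem' := fun r _ hz => smul_mem_middleRel (basisAct b ψ) r hz }
  have h := map_antiproduct_relabel hψ hL hσ hσ' (fun z hz => (hπ z).2 hz) x
  refine (hπ _).1 ?_
  rwa [← add_eq_right, ← map_add, sub_add_cancel]

theorem isHopfHom_relabel (hL : IsLeibnitz ψ) (hσ : KLT.IsAntipode σ)
    (hσ' : KLT.IsAntipode σ') : IsHopfHom ψ σ (basisAct b ψ) σ' (relabel b ψ) where
  map_one := relabel_one b ψ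
  map_mul := relabel_smashMul hψ hL
  map_counit := smashCounit_relabel
  map_comul := smashComul_relabel
  map_antiproduct := antiproduct_relabel_sub_mem hψ hL hσ hσ'

end RelabelAntiproduct

/-! ### Kernels of Hopf homomorphisms, and the theorem. -/

section HopfIdeal

variable {ψ : KLT k S →ₗ[k] Module.End k R} {σ : KLT k S →ₗ[k] KLT k S}
  {ψ' : KLT k ι →ₗ[k] Module.End k R} {σ' : KLT k ι →ₗ[k] KLT k ι}

theorem mem_of_add_eq_zero {A M : Type*} [Ring A] [AddCommMonoid M] [Module A M]
    {P : Submodule A M} {x y : M} (hx : x ∈ P) (h : x + y = 0) : y ∈ P := by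
  let := Module.addCommMonoidToAddCommGroup A (M := M)
  exact (P.add_mem_iff_right hx).1 (h ▸ P.zero_mem)

/-- The kernel of a surjective homomorphism of `R/k`-Hopf algebras is an `R/k`-Hopf ideal. -/
theorem isHopfIdeal_ker {α : Smash k R S →ₗ[R] Smash k R ι} (hα : IsHopfHom ψ σ ψ' σ' α)
    (hs : Function.Surjective α) : IsHopfIdeal ψ σ (LinearMap.ker α) := by
  let e := α.quotKerEquivOfSurjective hs
  have he : (LinearMap.ker α).mkQ = e.symm.toLinearMap ∘ₗ α := by
    refine LinearMap.ext fun x => ?_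
    rw [LinearMap.comp_apply, LinearEquiv.coe_coe, LinearEquiv.eq_symm_apply]
    rfl
  have hek : (LinearMap.ker α).mkQ.restrictScalars k =
      e.symm.toLinearMap.restrictScalars k ∘ₗ α.restrictScalars k := by
    rw [he]; rfl
  -- By surjectivity every generator of the middle relations in the target lifts to one in the
  -- source, with the same scalar `s`.
  have hrel : middleRel ψ' ≤
      (middleRel ψ).map (TensorProduct.map (α.restrictScalars k) (α.restrictScalars k)) := by
    refine Submodule.span_le.2 ?_
    rintro _ ⟨x, y, s, rfl⟩
    obtain ⟨x, rfl⟩ := hs x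
    obtain ⟨y, rfl⟩ := hs y
    have hc : α (s ⊗ₜ KLT.tree one) = s ⊗ₜ KLT.tree one := by
      rw [tmul_tree, tmul_tree, map_smul]
      exact congrArg _ hα.map_one
    refine ⟨_, Submodule.subset_span ⟨x, y, s, rfl⟩, ?_⟩
    simp only [map_sub, TensorProduct.map_tmul, LinearMap.coe_restrictScalars, hα.map_mul, hc]
  refine ⟨fun x y hy => ?_, fun x hx y => ?_, fun x hx => ?_, fun x hx => ?_, fun x hx => ?_⟩
  · rw [LinearMap.mem_ker] at hy ⊢
    rw [hα.map_mul, hy, map_zero]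
  · rw [LinearMap.mem_ker] at hx ⊢
    rw [hα.map_mul, hx, map_zero, LinearMap.zero_apply]
  · rw [← hα.map_counit, LinearMap.mem_ker.1 hx, map_zero]
  · rw [he, TensorProduct.map_comp, LinearMap.comp_apply, ← hα.map_comul, LinearMap.mem_ker.1 hx,
      map_zero, map_zero]
  · have h := hα.map_antiproduct x
    rw [LinearMap.mem_ker.1 hx, map_zero] at h
    replace h := mem_of_add_eq_zero h (sub_add_cancel _ _)
    rw [hek, TensorProduct.map_comp, Submodule.map_comp, LinearMap.comp_apply]
    exact Submodule.mem_map_of_mem (hrel h)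

end HopfIdeal

end Smash

theorem theorem5p1 {k : Type*} [Field k] {R : Type*} [CommRing R] [Algebra k R]
    {ι : Type*} (b : Module.Basis ι R (Derivation k R R))
    (ψ : KLT k (Derivation k R R) →ₗ[k] Module.End k R)
    (hψ : IsModuleAlgebra ψ) (hL : IsLeibnitz ψ) :
    ∃ α : Smash k R (Derivation k R R) →ₗ[R] Smash k R ι,
      IsRelabeling ψ b α ∧
      (∀ α' : Smash k R (Derivation k R R) →ₗ[R] Smash k R ι, IsRelabeling ψ b α' → α' = α) ∧
      LinearMap.ker α = leibnitzIdeal ψ ∧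
      (∃ (σ : KLT k (Derivation k R R) →ₗ[k] KLT k (Derivation k R R))
          (σ' : KLT k ι →ₗ[k] KLT k ι),
        KLT.IsAntipode σ ∧ KLT.IsAntipode σ' ∧
        IsHopfIdeal ψ σ (leibnitzIdeal ψ) ∧
        IsHopfHom ψ σ (ψ ∘ₗ KLT.mapLabel b) σ' α) ∧
      ∃ e : (Smash k R (Derivation k R R) ⧸ leibnitzIdeal ψ) ≃ₗ[R] Smash k R ι,
        ∀ x, e ((leibnitzIdeal ψ).mkQ x) = α x := by
  obtain ⟨σ, hσ⟩ := KLT.exists_isAntipode (k := k) (S := Derivation k R R)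
  obtain ⟨σ', hσ'⟩ := KLT.exists_isAntipode (k := k) (S := ι)
  have hs : Function.Surjective (Smash.relabel b ψ) :=
    fun y => ⟨Smash.ofBasis b y, Smash.relabel_ofBasis hψ y⟩
  have hα := Smash.isHopfHom_relabel (b := b) hψ hL hσ hσ'
  -- With the ideal written as a kernel, the Hopf ideal property and the isomorphism are facts about
  -- a surjective homomorphism.
  rw [← Smash.leibnitzIdeal_eq_ker (b := b) hψ hL]
  exact ⟨Smash.relabel b ψ, Smash.isRelabeling_relabel hψ hL, fun _ h => Smash.eq_relabel h, rfl,
    ⟨σ, σ', hσ, hσ', Smash.isHopfIdeal_ker hα hs, hα⟩,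
    (Smash.relabel b ψ).quotKerEquivOfSurjective hs, fun _ => rfl⟩
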